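/- Let $G$ and $H$ be countable groups. A sofic approximation to $G$ is a sequence $\Sigma=(\sigma_n)_{n\ge 1}$ of maps $\sigma_n:G\to\mathrm{Sym}(V_n)$, $g\mapsto\sigma_n^g$, with $V_n$ finite and non-empty, such that, as $n\to\infty$, $|\{v\in V_n:\sigma_n^g(\sigma_n^h(v))=\sigma_n^{gh}(v)\}|=(1-o(1))|V_n|$ for all $g,h\in G$ and $|\{v\in V_n:\sigma_n^g(v)\ne v\}|=(1-o(1))|V_n|$ for all $g\ne e$. Let $\Sigma$ be a sofic approximation to $G$ and let $\mathrm T=(\tau_n:H\to\mathrm{Sym}(W_n))_{n\ge 1}$ be a sofic approximation to $H$. Let $\Sigma\times\mathrm T$ be the sequence of maps $G\times H\to\mathrm{Sym}(V_n\times W_n)$, $(g,h)\mapsto\sigma_n^g\times\tau_n^h$. Let $(\mathcal X,d)$ be a compact metric space with its Borel $\sigma$-algebra, and let $\mu$ be a probability measure on $\mathcal X^G$ that is invariant under the coordinate shifts $(S^gx)_h=x_{hg}$. Let $\mu^{\times H}$ be the product measure on $(\mathcal X^G)^H=\mathcal X^{G\times H}$; this is the law of the co-induced $(G\times H)$-process.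 For $\sigma:G\to\mathrm{Sym}(V)$, $v\in V$ and $x\in\mathcal X^V$, let $\Pi^\sigma_v(x)=(x_{\sigma^g(v)})_{g\in G}\in\mathcal X^G$ and $P^\sigma_x=\frac1{|V|}\sum_{v\in V}\delta_{\Pi^\sigma_v(x)}$. Let $(\sigma_{n_i})_i$ be a subsequence of $\Sigma$ and let $\mu_i\in\Pr(\mathcal X^{V_{n_i}})$. We say that $(\mu_i)$ converges to $\mu$ locally weak$^*$ over $(\sigma_{n_i})$ if $|\{v\in V_{n_i}:(\Pi_v^{\sigma_{n_i}})_*\mu_i\in U\}|=(1-o(1))|V_{n_i}|$ for every weak$^*$ neighbourhood $U$ of $\mu$. It LE-converges if moreover $\mu_i\{x:P^{\sigma_{n_i}}_x\in U\}\to1$ for every such $U$. It LDE-converges if $\mu_i\times\mu_i$, regarded as a measure on $(\mathcal X\times\mathcal X)^{V_{n_i}}$, LE-converges to $\mu\times\mu$, regarded as a measure on $(\mathcal X\times\mathcal X)^G$. The model-measure sofic entropy is $$\mathrm h^{\mathrm m}_\Sigma(\mu)=\sup\Big\{\sup_{\varepsilon,\delta>0}\limsup_{i\to\infty}\frac1{|V_{n_i}|}\log\mathrm{cov}_{\varepsilon,\delta}(\mu_i,d^{(V_{n_i})}):\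 n_i\uparrow\infty,\ (\mu_i)\text{ LDE-converges to }\mu\text{ over }(\sigma_{n_i})\Big\},$$ where $d^{(V)}(x,y)=\frac1{|V|}\sum_{v\in V}d(x_v,y_v)$ and $\mathrm{cov}_{\varepsilon,\delta}(\nu,d^{(V)})$ is the least number of $\delta$-balls of $d^{(V)}$ needed to cover more than $1-\varepsilon$ of the measure $\nu$. The corresponding notions for $G\times H$, $\Sigma\times\mathrm T$ and $\mu^{\times H}$ are defined in the same way. Suprema of empty sets are $-\infty$. Let $\mathfrak P$ be a family of finite Borel partitions of $\mathcal X$ such that (Pi) for every $\delta>0$ some $\mathcal P\in\mathfrak P$ has all its cells of diameter less than $\delta$; (Pii) $\mu\{x\in\mathcal X^G:x_e\in\partial C\}=0$ for every cell $C$ of every $\mathcal P\in\mathfrak P$. For $\mathcal P\in\mathfrak P$ let $\mathcal P^V$ be the partition of $\mathcal X^V$ into products of cells of $\mathcal P$, and let $\mathrm H_\nu(\mathcal P^V)=-\sum_{C\in\mathcal P^V}\nu(C)\log\nu(C)$. **Theorem C.** If $|W_n|\to\infty$, then $$\mathrm h^{\mathrm m}_{\Sigma\times\mathrm T}(\mu^{\times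 H})=\sup\Big\{\limsup_{i\to\infty}\frac1{|V_{n_i}|}\mathrm H_{\mu_i}(\mathcal P^{V_{n_i}}):\ \mathcal P\in\mathfrak P,\ n_i\uparrow\infty,\ (\mu_i)\text{ converges to }\mu\text{ locally weak}^*\text{ over }(\sigma_{n_i})\Big\}.$$ -/

import Mathlib

open MeasureTheory Filter Topology

namespace SoficEntropy

noncomputable section

universe u v w

/-- The proportion of the points of a finite set `V` that have the property `p`. -/
def proportion {V : Type v} [Fintype V] (p : V → Prop) : ℝ :=
  ({a : V | p a}.ncard : ℝ) / (Fintype.card V : ℝ)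

/-- `σ = (σ n)`, a sequence of maps `σ n : G → Sym(V n)` into the permutation groups of finite
sets, is a sofic approximation to the group `G`: asymptotically almost everywhere it is
multiplicative and free.  No `σ n` has to be a homomorphism. -/
structure IsSoficApprox {G : Type u} [Group G] {V : ℕ → Type v} [∀ n, Fintype (V n)]
    (σ : ∀ n, G → Equiv.Perm (V n)) : Prop where
  mul : ∀ g h : G,
    Tendsto (fun n => proportion fun a : V n => σ n g (σ n h a) = σ n (g * h) a) atTop (𝓝 1)
  free : ∀ g : G, g ≠ 1 →
    Tendsto (fun n => proportion fun a : V n => σ n g a ≠ a) atTop (𝓝 1)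

/-- The Cartesian product maps `(g, h) ↦ σ n g × τ n h` on `V n × W n`. -/
def prodApprox {G : Type*} {H : Type*} {V : ℕ → Type*} {W : ℕ → Type*}
    (σ : ∀ n, G → Equiv.Perm (V n)) (τ : ∀ n, H → Equiv.Perm (W n)) :
    ∀ n, G × H → Equiv.Perm (V n × W n) :=
  fun n p => (σ n p.1).prodCongr (τ n p.2)

/-- A measure on `X ^ G` is invariant under the coordinate shift action
`(S^g x)_h = x_{hg}` of `G`.  This is the left action with respect to which pullback names are
approximately equivariant. -/
def ShiftInvariant {G : Type u} [Group G] {X : Type w} [MeasurableSpace X]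
    (μ : ProbabilityMeasure (G → X)) : Prop :=
  ∀ g : G, MeasurePreserving (fun (x : G → X) (h : G) => x (h * g))
    (μ : Measure (G → X)) (μ : Measure (G → X))

/-- The pullback name `(x_{σ^g(a)})_{g ∈ G}` of `x` at the vertex `a`. -/
def pullbackName {G : Type u} {V : Type v} {X : Type w} (σ : G → Equiv.Perm V) (a : V)
    (x : V → X) : G → X :=
  fun g => x (σ g a)

theorem measurable_pullbackName {G : Type u} {V : Type v} {X : Type w} [MeasurableSpace X]
    (σ : G → Equiv.Perm V) (a : V) :
    Measurable (pullbackName σ a : (V → X) → (G → X)) :=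
  measurable_pi_lambda _ fun g => measurable_pi_apply (σ g a)

/-- The push-forward of a measure on `X ^ V` under the pullback-name map at the vertex `a`. -/
def localMarginal {G : Type u} {V : Type v} {X : Type w} [MeasurableSpace X]
    (σ : G → Equiv.Perm V) (ν : ProbabilityMeasure (V → X)) (a : V) :
    ProbabilityMeasure (G → X) :=
  ν.map (measurable_pullbackName σ a).aemeasurable

/-- The empirical distribution of `x ∈ X ^ V`: the average over `a ∈ V` of the point masses at
the pullback names of `x`. -/
def empirical {G : Type u} {V : Type v} {X : Type w} [Fintype V] [Nonempty V]
    [MeasurableSpace X] (σ : G → Equiv.Perm V) (x : V → X) : ProbabilityMeasure (G → X) :=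
  ⟨(Fintype.card V : ENNReal)⁻¹ • ∑ a : V, Measure.dirac (pullbackName σ a x), ⟨by
    simp only [Measure.smul_apply, Measure.coe_finsetSum, Finset.sum_apply, measure_univ,
      Finset.sum_const, Finset.card_univ, nsmul_eq_mul, mul_one, smul_eq_mul]
    exact ENNReal.inv_mul_cancel (by simp) (by simp)⟩⟩

/-- The `U`-good models over `σ`: those `x ∈ X ^ V` whose empirical distribution lies in `U`. -/
def goodModels {G : Type u} {V : Type v} {X : Type w} [Fintype V] [Nonempty V]
    [MeasurableSpace X] (σ : G → Equiv.Perm V) (U : Set (ProbabilityMeasure (G → X))) :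
    Set (V → X) :=
  {x | empirical σ x ∈ U}

/-- The product `ν × ν'`, as a measure on `(X × Y) ^ ι` rather than on `X ^ ι × Y ^ ι`. -/
def pairMeasure {ι : Type*} {X : Type*} {Y : Type*} [MeasurableSpace X] [MeasurableSpace Y]
    (ν : ProbabilityMeasure (ι → X)) (ν' : ProbabilityMeasure (ι → Y)) :
    ProbabilityMeasure (ι → X × Y) :=
  (ν.prod ν').map (f := fun p i => (p.1 i, p.2 i))
    (measurable_pi_lambda _ fun i =>
      ((measurable_pi_apply i).comp measurable_fst).prodMk
        ((measurable_pi_apply i).comp measurable_snd)).aemeasurable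

section Convergence

variable {G : Type u} [Countable G] {X : Type w} [MetricSpace X] [CompactSpace X]
  [MeasurableSpace X] [BorelSpace X] {V : ℕ → Type v} [∀ i, Fintype (V i)] [∀ i, Nonempty (V i)]

/-- `ν i ∈ Pr(X ^ (V i))` locally weak* converges to `μ` over `σ`.  Here `𝓝 μ` refers to the
weak* topology on `Pr(X ^ G)`, where `X ^ G` carries the product topology. -/
def LWConverges (σ : ∀ i, G → Equiv.Perm (V i)) (ν : ∀ i, ProbabilityMeasure (V i → X))
    (μ : ProbabilityMeasure (G → X)) : Prop :=
  ∀ U ∈ 𝓝 μ,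
    Tendsto (fun i => proportion fun a : V i => localMarginal (σ i) (ν i) a ∈ U) atTop (𝓝 1)

/-- Local and empirical convergence. -/
def LEConverges (σ : ∀ i, G → Equiv.Perm (V i)) (ν : ∀ i, ProbabilityMeasure (V i → X))
    (μ : ProbabilityMeasure (G → X)) : Prop :=
  LWConverges σ ν μ ∧
    ∀ U ∈ 𝓝 μ,
      Tendsto (fun i => (ν i : Measure (V i → X)).real (goodModels (σ i) U)) atTop (𝓝 1)

/-- Local and doubly empirical convergence: `ν i × ν i` converges locally and empirically to
`μ × μ`, as measures on `(X × X) ^ (V i)` and on `(X × X) ^ G`. -/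
def LDEConverges (σ : ∀ i, G → Equiv.Perm (V i)) (ν : ∀ i, ProbabilityMeasure (V i → X))
    (μ : ProbabilityMeasure (G → X)) : Prop :=
  LEConverges σ (fun i => pairMeasure (ν i) (ν i)) (pairMeasure μ μ)

end Convergence

/-- The Hamming average of the metric of `X` on `X ^ V`. -/
def hammingAverage {V : Type v} [Fintype V] {X : Type w} [MetricSpace X] (x y : V → X) : ℝ :=
  (∑ a : V, dist (x a) (y a)) / (Fintype.card V : ℝ)

/-- The least number of `δ`-balls of the Hamming average metric that are needed to cover more than
`1 - ε` of the measure `ν`.  It is at least `1` if `ε ≤ 1`. -/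
def coveringNumber {V : Type v} [Fintype V] {X : Type w} [MetricSpace X] [MeasurableSpace X]
    (ε δ : ℝ) (ν : ProbabilityMeasure (V → X)) : ℕ :=
  sInf {k : ℕ | ∃ F : Finset (V → X), F.card = k ∧
    1 - ε < (ν : Measure (V → X)).real (⋃ x ∈ F, {y | hammingAverage y x < δ})}

/-- The model-measure sofic entropy of `μ` relative to `σ`; it is `⊥ = -∞` if no sequence of
measures over a subsequence of `σ` LDE converges to `μ`. -/
def modelMeasureEntropy {G : Type u} [Countable G] {X : Type w} [MetricSpace X] [CompactSpace X]
    [MeasurableSpace X] [BorelSpace X] {V : ℕ → Type v} [∀ n, Fintype (V n)]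
    [∀ n, Nonempty (V n)] (σ : ∀ n, G → Equiv.Perm (V n)) (μ : ProbabilityMeasure (G → X)) :
    EReal :=
  ⨆ (n : ℕ → ℕ) (_ : StrictMono n) (ν : ∀ i, ProbabilityMeasure (V (n i) → X))
    (_ : LDEConverges (fun i => σ (n i)) ν μ) (ε : ℝ) (_ : 0 < ε) (δ : ℝ) (_ : 0 < δ),
    limsup (fun i =>
      ((Real.log (coveringNumber ε δ (ν i)) / Fintype.card (V (n i)) : ℝ) : EReal)) atTop

/-- The Shannon entropy of `ν` with respect to a finite set `Q` of disjoint measurable sets. -/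
def shannonEntropy {Ω : Type*} [MeasurableSpace Ω] (ν : ProbabilityMeasure Ω)
    (Q : Finset (Set Ω)) : ℝ :=
  ∑ C ∈ Q, Real.negMulLog ((ν : Measure Ω).real C)

open Classical in
/-- The cells of `P ^ V`: the products of cells of `P`, one for each element of `V`. -/
def productCells (V : Type v) [Fintype V] {X : Type w} (P : Finpartition (Set.univ : Set X)) :
    Finset (Set (V → X)) :=
  (Fintype.piFinset fun _ : V => P.parts).image fun c => Set.univ.pi c

/-- `𝔓` is a family of finite Borel partitions of `X`. -/
def IsBorelFamily {X : Type w} [MeasurableSpace X]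
    (𝔓 : Set (Finpartition (Set.univ : Set X))) : Prop :=
  ∀ P ∈ 𝔓, ∀ C ∈ P.parts, MeasurableSet C

/-- `𝔓` contains partitions into cells of arbitrarily small diameter. -/
def HasSmallCells {X : Type w} [MetricSpace X]
    (𝔓 : Set (Finpartition (Set.univ : Set X))) : Prop :=
  ∀ δ : ℝ, 0 < δ → ∃ P ∈ 𝔓, ∀ C ∈ P.parts, Metric.diam C < δ

/-- Every cell of every partition in `𝔓` is a continuity set for the marginal of `μ` at the
identity. -/
def HasContinuityCells {G : Type u} [Group G] {X : Type w} [MetricSpace X] [MeasurableSpace X]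
    (μ : ProbabilityMeasure (G → X)) (𝔓 : Set (Finpartition (Set.univ : Set X))) : Prop :=
  ∀ P ∈ 𝔓, ∀ C ∈ P.parts, (μ : Measure (G → X)) {x | x 1 ∈ frontier C} = 0

/-- The supremum of the upper Shannon entropy rates, relative to partitions in `𝔓`, of sequences
of measures over subsequences of `σ` that locally weak* converge to `μ`; it is `⊥ = -∞` if there
are none. -/
def lwShannonEntropy {G : Type u} [Countable G] {X : Type w} [MetricSpace X] [CompactSpace X]
    [MeasurableSpace X] [BorelSpace X] {V : ℕ → Type v} [∀ n, Fintype (V n)]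
    [∀ n, Nonempty (V n)] (σ : ∀ n, G → Equiv.Perm (V n)) (μ : ProbabilityMeasure (G → X))
    (𝔓 : Set (Finpartition (Set.univ : Set X))) : EReal :=
  ⨆ (P : Finpartition (Set.univ : Set X)) (_ : P ∈ 𝔓) (n : ℕ → ℕ) (_ : StrictMono n)
    (ν : ∀ i, ProbabilityMeasure (V (n i) → X)) (_ : LWConverges (fun i => σ (n i)) ν μ),
    limsup (fun i =>
      ((shannonEntropy (ν i) (productCells (V (n i)) P) / Fintype.card (V (n i)) : ℝ) : EReal))
      atTop

/-- The measure `μ ^ H` on `X ^ (G × H)`, which is `(X ^ G) ^ H` with its coordinates regrouped: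
the law of the co-induction to `G × H` of the `G`-process with law `μ`. -/
def coinduced {G : Type*} (H : Type*) {X : Type*} [MeasurableSpace X]
    (μ : ProbabilityMeasure (G → X)) : ProbabilityMeasure (G × H → X) :=
  ProbabilityMeasure.map
    (⟨Measure.infinitePi fun _ : H => (μ : Measure (G → X)), inferInstance⟩ :
      ProbabilityMeasure (H → G → X))
    (f := fun y p => y p.2 p.1)
    (measurable_pi_lambda _ fun p =>
      (measurable_pi_apply p.1).comp (measurable_pi_apply p.2)).aemeasurable

end

end SoficEntropy

open SoficEntropy

/-! Two constructions relate measures on `X ^ V` to measures on `X ^ (V × W)`: independent copies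
over `W`, and averaging of marginals over `W`.

For `lwShannonEntropy ≤ modelMeasureEntropy`, take `ν i` converging locally weak* to `μ` and form
the product of `|W i|` copies of `ν i`. Near a vertex `(v, w)`, a test function involving a finite
`K ⊆ H` sees the slices `τ^h w`, `h ∈ K`. For most `w` these are distinct, hence independent, so the
local marginals approach `μ^H`. The empirical averages concentrate because each slice function is
correlated with at most `|K|^2` others, which makes the variance `O(|K|^2 / |W|)`. Double
convergence costs nothing more, because pairing commutes with both constructions
(`pairMeasure_coinduced`, `LWConverges.pair`). The Shannon entropy of the product is exactly `|W|`
times that of `ν i` (`labelEntropy_coinduced`). The Fano inequality `labelEntropy_div_card_le`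
bounds it by a logarithm of a covering number; the null boundaries of the cells make nearby points
carry equal labels at most vertices.

For the reverse inequality, let `ν i` LDE converge to `μ^H` with covering number `N`. Conditioning
on the union of cells of mass at most `1 / N` costs a bounded density and gives entropy at least
`log N` up to a constant (`exists_labelEntropy_ge`). Averaging the marginals over `W` loses no
entropy per vertex, by subadditivity and concavity (`labelEntropy_le_averageMarginal`). The averages
still converge to `μ` locally weak*, although the conditioned measures may fail to LDE converge: for
a centred test function, the mean square of its local integrals is an integral over two independent
copies, which double empirical convergence sends to zero, and domination by a multiple of `ν i × ν
i` preserves this (`sq_localDiscrepancy_averageMarginal_le`). The constant lost by conditioning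
disappears on division by `|V| |W|`. -/

namespace SoficEntropy

noncomputable section

/-! ### Weak* convergence tested on continuous functions -/

section TestFunctions

variable {Y : Type*} [TopologicalSpace Y] [CompactSpace Y]

/-- By the Stone-Weierstrass theorem, a sequence of uniformly bounded seminorms on `C(Y, ℝ)` that
tends to zero on a submonoid that separates points tends to zero everywhere. -/
theorem tendsto_seminorm_of_separatesPoints (D : ℕ → Seminorm ℝ C(Y, ℝ)) {B : ℝ}
    (hB : ∀ i f, D i f ≤ B * ‖f‖) (S : Submonoid C(Y, ℝ))
    (hS : ∀ x y : Y, x ≠ y → ∃ f ∈ S, f x ≠ f y)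
    (hD : ∀ f ∈ S, Tendsto (fun i => D i f) atTop (𝓝 0)) (f : C(Y, ℝ)) :
    Tendsto (fun i => D i f) atTop (𝓝 0) := by
  have hspan : ∀ g ∈ Submodule.span ℝ (S : Set C(Y, ℝ)),
      Tendsto (fun i => D i g) atTop (𝓝 0) := by
    intro g hg
    induction hg using Submodule.span_induction with
    | mem x hx => exact hD x hx
    | zero => simp
    | add x y _ _ hx hy =>
      refine squeeze_zero (fun i => apply_nonneg _ _) (fun i => map_add_le_add (D i) x y) ?_
      simpa using hx.add hy
    | smul c x _ hx =>
      simp only [map_smul_eq_mul]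
      simpa using hx.const_mul ‖c‖
  have hsep : (Algebra.adjoin ℝ (S : Set C(Y, ℝ))).SeparatesPoints := by
    intro x y hxy
    obtain ⟨g, hg, hgxy⟩ := hS x y hxy
    exact ⟨g, ⟨g, Algebra.subset_adjoin hg, rfl⟩, hgxy⟩
  have hmem := ContinuousMap.continuousMap_mem_subalgebra_closure_of_separatesPoints _ hsep f
  have hmem' : f ∈ closure (Algebra.adjoin ℝ (S : Set C(Y, ℝ)) : Set C(Y, ℝ)) := hmem
  rw [Metric.tendsto_atTop]
  intro ε hε
  -- `|B| + 1` is positive and dominates `B`, whatever the sign of `B`.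
  obtain ⟨g, hg, hfg⟩ := Metric.mem_closure_iff.1 hmem' (ε / (2 * (|B| + 1))) (by positivity)
  -- Since `S` is closed under multiplication, the algebra it generates is its linear span, so the
  -- seminorms need no compatibility with products.
  have hg' : g ∈ Submodule.span ℝ (S : Set C(Y, ℝ)) := by
    have h1 : g ∈ Subalgebra.toSubmodule (Algebra.adjoin ℝ (S : Set C(Y, ℝ))) := hg
    rwa [Algebra.adjoin_eq_span, Submonoid.closure_eq] at h1
  obtain ⟨N, hN⟩ := Metric.tendsto_atTop.1 (hspan g hg') (ε / 2) (by positivity)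
  refine ⟨N, fun i hi => ?_⟩
  have h1 := hN i hi
  rw [Real.dist_0_eq_abs, abs_of_nonneg (apply_nonneg _ _)] at h1 ⊢
  have h2 : D i f ≤ D i (f - g) + D i g := by
    simpa using map_add_le_add (D i) (f - g) g
  have h3 : D i (f - g) ≤ ε / 2 := by
    rw [dist_eq_norm] at hfg
    calc D i (f - g) ≤ B * ‖f - g‖ := hB i _
      _ ≤ (|B| + 1) * ‖f - g‖ := by gcongr; linarith [le_abs_self B]
      _ ≤ (|B| + 1) * (ε / (2 * (|B| + 1))) := by gcongr
      _ = ε / 2 := by field_simp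
  linarith

variable [MeasurableSpace Y] [OpensMeasurableSpace Y]

theorem integrable_continuousMap (m : Measure Y) [IsFiniteMeasure m] (f : C(Y, ℝ)) :
    Integrable f m :=
  Integrable.of_bound f.continuous.measurable.aestronglyMeasurable ‖f‖
    (ae_of_all _ fun x => f.norm_coe_le_norm x)

omit [OpensMeasurableSpace Y] in
theorem abs_integral_le_norm (m : Measure Y) [IsProbabilityMeasure m] (f : C(Y, ℝ)) :
    |∫ y, f y ∂m| ≤ ‖f‖ := by
  have := norm_integral_le_of_norm_le_const (μ := m) (ae_of_all _ fun x => f.norm_coe_le_norm x)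
  simpa using this

/-- The discrepancy of the integrals with respect to two probability measures. -/
def discrepancy (m μ : ProbabilityMeasure Y) : Seminorm ℝ C(Y, ℝ) :=
  Seminorm.of (fun f => |∫ y, f y ∂(m : Measure Y) - ∫ y, f y ∂(μ : Measure Y)|)
    (fun f g => by
      simp only [ContinuousMap.add_apply]
      rw [integral_add (integrable_continuousMap _ f) (integrable_continuousMap _ g),
        integral_add (integrable_continuousMap _ f) (integrable_continuousMap _ g),
        add_sub_add_comm]
      exact abs_add_le _ _)
    (fun c f => by
      simp only [ContinuousMap.smul_apply, smul_eq_mul, integral_const_mul, ← mul_sub, abs_mul,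
        Real.norm_eq_abs])

theorem discrepancy_apply (m μ : ProbabilityMeasure Y) (f : C(Y, ℝ)) :
    discrepancy m μ f = |∫ y, f y ∂(m : Measure Y) - ∫ y, f y ∂(μ : Measure Y)| := rfl

theorem discrepancy_le (m μ : ProbabilityMeasure Y) (f : C(Y, ℝ)) :
    discrepancy m μ f ≤ 2 * ‖f‖ := by
  rw [discrepancy_apply]
  have h1 := abs_integral_le_norm (m : Measure Y) f
  have h2 := abs_integral_le_norm (μ : Measure Y) f
  have h3 := abs_sub (∫ y, f y ∂(m : Measure Y)) (∫ y, f y ∂(μ : Measure Y))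
  linarith

/-- The weak* topology is induced by the integrals of continuous functions, so a neighbourhood
contains a box that constrains finitely many of them. -/
theorem exists_discrepancy_lt_subset {μ : ProbabilityMeasure Y} {U : Set (ProbabilityMeasure Y)}
    (hU : U ∈ 𝓝 μ) :
    ∃ (F : Finset C(Y, ℝ)) (c : ℝ), 0 < c ∧ ∀ m, (∀ f ∈ F, discrepancy m μ f < c) → m ∈ U := by
  let φ : ProbabilityMeasure Y → (C(Y, ℝ) → ℝ) := fun m f => ∫ y, f y ∂(m : Measure Y)
  have h : Tendsto (id : ProbabilityMeasure Y → ProbabilityMeasure Y) (comap φ (𝓝 (φ μ)))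
      (𝓝 μ) := by
    rw [ProbabilityMeasure.tendsto_iff_forall_integral_tendsto]
    intro f
    have h1 : Tendsto (fun m => φ m f.toContinuousMap) (comap φ (𝓝 (φ μ)))
        (𝓝 (φ μ f.toContinuousMap)) :=
      ((continuous_apply f.toContinuousMap).tendsto (φ μ)).comp tendsto_comap
    exact h1
  have h2 : U ∈ comap φ (𝓝 (φ μ)) := h hU
  obtain ⟨T, hT, hTU⟩ := h2
  rw [nhds_pi, Filter.mem_pi] at hT
  obtain ⟨I, hI, t, ht, htT⟩ := hT
  choose r hr hrt using fun f => Metric.mem_nhds_iff.1 (ht f)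
  -- Inserting `1` makes the minimum meaningful when there is no test function.
  refine ⟨hI.toFinset, (insert 1 (hI.toFinset.image r)).min' (by simp), ?_, fun m hm => ?_⟩
  · rw [Finset.lt_min'_iff]
    intro y hy
    rcases Finset.mem_insert.1 hy with rfl | hy
    · exact one_pos
    · obtain ⟨f, -, rfl⟩ := Finset.mem_image.1 hy
      exact hr f
  · refine hTU (htT fun f hf => hrt f ?_)
    have hfI : f ∈ hI.toFinset := hI.mem_toFinset.2 hf
    rw [Metric.mem_ball, Real.dist_eq]
    exact (hm f hfI).trans_le
      (Finset.min'_le _ _ (Finset.mem_insert_of_mem (Finset.mem_image_of_mem r hfI)))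

theorem setOf_discrepancy_lt_mem_nhds (μ : ProbabilityMeasure Y) (f : C(Y, ℝ)) {c : ℝ}
    (hc : 0 < c) : {m | discrepancy m μ f < c} ∈ 𝓝 μ := by
  have h1 : Continuous fun m : ProbabilityMeasure Y => discrepancy m μ f := by
    simp only [discrepancy_apply]
    exact ((ProbabilityMeasure.continuous_integral_continuousMap f).sub continuous_const).abs
  exact (isOpen_lt h1 continuous_const).mem_nhds (by simpa [discrepancy_apply] using hc)

end TestFunctions

/-! ### Proportions of vertices -/

section Proportion

variable {V : Type*} [Fintype V]

theorem proportion_le_one (p : V → Prop) : proportion p ≤ 1 := by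
  unfold proportion
  refine div_le_one_of_le₀ ?_ (by positivity)
  have := Set.ncard_le_card {a | p a}
  exact_mod_cast this.trans_eq Nat.card_eq_fintype_card

theorem proportion_not [Nonempty V] (p : V → Prop) :
    proportion (fun a => ¬ p a) = 1 - proportion p := by
  classical
  have h := Set.ncard_add_ncard_compl {a | p a}
  rw [Nat.card_eq_fintype_card] at h
  have h' : (({a | p a}.ncard : ℝ)) + ({a | p a}ᶜ.ncard : ℝ) = Fintype.card V := by exact_mod_cast h
  have hV : (Fintype.card V : ℝ) ≠ 0 := by simp
  unfold proportion
  rw [eq_sub_iff_add_eq, ← add_div, div_eq_one_iff_eq hV, ← h', add_comm]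
  rfl

theorem proportion_mono {p q : V → Prop} (h : ∀ a, p a → q a) : proportion p ≤ proportion q := by
  unfold proportion
  gcongr
  · exact Set.toFinite _
  · exact h _

theorem proportion_eq_average [DecidableEq V] (p : V → Prop) [DecidablePred p] :
    proportion p = (∑ a, if p a then (1 : ℝ) else 0) / Fintype.card V := by
  unfold proportion
  congr 1
  rw [Finset.sum_boole, Set.ncard_eq_toFinset_card']
  simp

end Proportion

/-! ### Integrals against local marginals and empirical distributions -/

section Models

variable {G : Type*} {V : Type*} {X : Type*} [Fintype V]

omit [Fintype V] in
theorem continuous_pullbackName [TopologicalSpace X] (σ : G → Equiv.Perm V) (a : V) :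
    Continuous (pullbackName σ a : (V → X) → (G → X)) :=
  continuous_pi fun g => continuous_apply (σ g a)

variable [MeasurableSpace X]

omit [Fintype V] in
theorem integral_localMarginal (σ : G → Equiv.Perm V) (ν : ProbabilityMeasure (V → X)) (a : V)
    {f : (G → X) → ℝ} (hf : StronglyMeasurable f) :
    ∫ y, f y ∂(localMarginal σ ν a : Measure (G → X)) =
      ∫ x, f (pullbackName σ a x) ∂(ν : Measure (V → X)) := by
  rw [localMarginal, ProbabilityMeasure.toMeasure_map,
    integral_map (measurable_pullbackName σ a).aemeasurable hf.aestronglyMeasurable]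

theorem integral_empirical [Nonempty V] (σ : G → Equiv.Perm V) (x : V → X)
    {f : (G → X) → ℝ} (hf : StronglyMeasurable f) :
    ∫ y, f y ∂(empirical σ x : Measure (G → X)) =
      (∑ a, f (pullbackName σ a x)) / Fintype.card V := by
  rw [empirical, ProbabilityMeasure.coe_mk, integral_smul_measure, integral_finsetSum_measure]
  · simp only [integral_dirac' _ _ hf, ENNReal.toReal_inv, ENNReal.toReal_natCast, smul_eq_mul]
    rw [div_eq_inv_mul]
  · exact fun a _ => integrable_dirac' hf (by simp)

/-- The average over the vertices of a finite set of a function. -/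
def average {V : Type*} [Fintype V] (u : V → ℝ) : ℝ := (∑ a, u a) / Fintype.card V

end Models

/-! ### Averages over vertices -/

section Average

variable {V W : Type*} [Fintype V] [Fintype W]

theorem average_mono {u u' : V → ℝ} (h : ∀ a, u a ≤ u' a) : average u ≤ average u' :=
  div_le_div_of_nonneg_right (Finset.sum_le_sum fun a _ => h a) (by positivity)

theorem average_add (u u' : V → ℝ) :
    average (fun a => u a + u' a) = average u + average u' := by
  simp [average, Finset.sum_add_distrib, add_div]

theorem average_const_mul (c : ℝ) (u : V → ℝ) :
    average (fun a => c * u a) = c * average u := by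
  simp [average, ← Finset.mul_sum, mul_div_assoc]

theorem average_const [Nonempty V] (c : ℝ) : average (fun _ : V => c) = c := by
  simp [average]

theorem average_sub (u u' : V → ℝ) :
    average (fun a => u a - u' a) = average u - average u' := by
  simp [average, Finset.sum_sub_distrib, sub_div]

theorem abs_average_le (u : V → ℝ) : |average u| ≤ average fun a => |u a| := by
  rw [average, average, abs_div, Nat.abs_cast]
  gcongr
  exact Finset.abs_sum_le_sum_abs _ _

theorem average_sq_le (u : V → ℝ) : average u ^ 2 ≤ average fun a => u a ^ 2 := by
  rcases isEmpty_or_nonempty V with hV | hV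
  · simp [average]
  · have h := sq_sum_le_card_mul_sum_sq (s := (Finset.univ : Finset V)) (f := u)
    rw [average, average, div_pow, div_le_div_iff₀ (by positivity) (by positivity)]
    rw [Finset.card_univ] at h
    nlinarith [(Nat.cast_nonneg (Fintype.card V) : (0 : ℝ) ≤ Fintype.card V)]

theorem average_prod (u : V × W → ℝ) :
    average u = average fun v => average fun w => u (v, w) := by
  simp only [average, Fintype.sum_prod_type, Fintype.card_prod, Nat.cast_mul, ← Finset.sum_div]
  rw [div_div, mul_comm (Fintype.card V : ℝ)]

theorem average_comm (u : V → W → ℝ) :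
    (average fun v => average fun w => u v w) = average fun w => average fun v => u v w := by
  simp only [average, ← Finset.sum_div]
  rw [Finset.sum_comm, div_right_comm]

theorem average_equiv (e : V ≃ W) (u : W → ℝ) : (average fun v => u (e v)) = average u := by
  rw [average, average, Equiv.sum_comp e, Fintype.card_congr e]

/-- Markov's inequality for the uniform measure on the vertices. -/
theorem proportion_le_average [Nonempty V] (p : V → Prop) {u : V → ℝ} {c : ℝ} (hc : 0 < c)
    (hu : ∀ a, 0 ≤ u a) (h : ∀ a, p a → c ≤ u a) : proportion p ≤ average u / c := by
  classical
  rw [proportion_eq_average, average, div_right_comm]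
  gcongr
  rw [Finset.sum_div]
  refine Finset.sum_le_sum fun a _ => ?_
  split_ifs with ha
  · rw [one_le_div hc]; exact h a ha
  · exact div_nonneg (hu a) hc.le

theorem average_le_proportion [Nonempty V] (p : V → Prop) {u : V → ℝ} {c B : ℝ}
    (hu : ∀ a, u a ≤ c + B) (h : ∀ a, p a → u a ≤ c) :
    average u ≤ c + B * (1 - proportion p) := by
  classical
  rw [← proportion_not, proportion_eq_average]
  have : average u ≤ average fun a => c + B * if ¬ p a then (1 : ℝ) else 0 := by
    refine average_mono fun a => ?_
    split_ifs with ha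
    · simpa using h a ha
    · simpa using hu a
  rwa [average_add, average_const, average_const_mul] at this

theorem integral_average {Ω : Type*} [MeasurableSpace Ω] (m : Measure Ω) {f : V → Ω → ℝ}
    (hf : ∀ a, Integrable (f a) m) :
    ∫ x, average (fun a => f a x) ∂m = average fun a => ∫ x, f a x ∂m := by
  simp only [average]
  rw [integral_div, integral_finsetSum _ fun a _ => hf a]

end Average

/-! ### Convergence of measures as convergence of seminorms to zero -/

section Characterizations

variable {G : Type*} [Countable G] {X : Type*} [MetricSpace X] [CompactSpace X]
  [MeasurableSpace X] [BorelSpace X]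

section

variable {V : Type*} [Fintype V]

/-- The average over the vertices of the discrepancy between the local marginal and `μ`. -/
def localDiscrepancy (σ : G → Equiv.Perm V) (ν : ProbabilityMeasure (V → X))
    (μ : ProbabilityMeasure (G → X)) : Seminorm ℝ C(G → X, ℝ) :=
  Seminorm.of (fun f => average fun a => discrepancy (localMarginal σ ν a) μ f)
    (fun f g => by
      rw [← average_add]
      exact average_mono fun a => map_add_le_add _ f g)
    (fun c f => by simp only [map_smul_eq_mul, average_const_mul])

theorem localDiscrepancy_apply (σ : G → Equiv.Perm V) (ν : ProbabilityMeasure (V → X))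
    (μ : ProbabilityMeasure (G → X)) (f : C(G → X, ℝ)) :
    localDiscrepancy σ ν μ f = average fun a =>
      |∫ x, f (pullbackName σ a x) ∂(ν : Measure (V → X)) - ∫ y, f y ∂(μ : Measure (G → X))| := by
  simp only [← integral_localMarginal σ ν _ f.continuous.stronglyMeasurable,
    ← discrepancy_apply]
  rfl

variable [Nonempty V]

theorem localDiscrepancy_le (σ : G → Equiv.Perm V) (ν : ProbabilityMeasure (V → X))
    (μ : ProbabilityMeasure (G → X)) (f : C(G → X, ℝ)) :
    localDiscrepancy σ ν μ f ≤ 2 * ‖f‖ :=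
  (average_mono fun _ => discrepancy_le _ _ _).trans_eq (average_const _)

theorem discrepancy_empirical (σ : G → Equiv.Perm V) (x : V → X)
    (μ : ProbabilityMeasure (G → X)) (f : C(G → X, ℝ)) :
    discrepancy (empirical σ x) μ f =
      |(average fun a => f (pullbackName σ a x)) - ∫ y, f y ∂(μ : Measure (G → X))| := by
  rw [discrepancy_apply, integral_empirical _ _ f.continuous.stronglyMeasurable]
  rfl

theorem continuous_discrepancy_empirical (σ : G → Equiv.Perm V)
    (μ : ProbabilityMeasure (G → X)) (f : C(G → X, ℝ)) :
    Continuous fun x : V → X => discrepancy (empirical σ x) μ f := by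
  simp only [discrepancy_empirical, average]
  have := fun a => f.continuous.comp (continuous_pullbackName σ a)
  exact (((continuous_finsetSum _ fun a _ => this a).div_const _).sub continuous_const).abs

theorem integrable_discrepancy_empirical (σ : G → Equiv.Perm V)
    (μ : ProbabilityMeasure (G → X)) (f : C(G → X, ℝ)) (ν : Measure (V → X))
    [IsFiniteMeasure ν] :
    Integrable (fun x : V → X => discrepancy (empirical σ x) μ f) ν :=
  integrable_continuousMap ν ⟨_, continuous_discrepancy_empirical σ μ f⟩

/-- The mean of the discrepancy between the empirical distribution and `μ`. -/
def empiricalDiscrepancy (σ : G → Equiv.Perm V) (ν : ProbabilityMeasure (V → X))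
    (μ : ProbabilityMeasure (G → X)) : Seminorm ℝ C(G → X, ℝ) :=
  Seminorm.of (fun f => ∫ x, discrepancy (empirical σ x) μ f ∂(ν : Measure (V → X)))
    (fun f g => by
      rw [← integral_add (integrable_discrepancy_empirical σ μ f _)
        (integrable_discrepancy_empirical σ μ g _)]
      exact integral_mono (integrable_discrepancy_empirical σ μ (f + g) _)
        ((integrable_discrepancy_empirical σ μ f _).add
        (integrable_discrepancy_empirical σ μ g _)) fun x => map_add_le_add _ f g)
    (fun c f => by simp only [map_smul_eq_mul, integral_const_mul])

theorem empiricalDiscrepancy_apply (σ : G → Equiv.Perm V) (ν : ProbabilityMeasure (V → X))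
    (μ : ProbabilityMeasure (G → X)) (f : C(G → X, ℝ)) :
    empiricalDiscrepancy σ ν μ f =
      ∫ x, discrepancy (empirical σ x) μ f ∂(ν : Measure (V → X)) := rfl

theorem empiricalDiscrepancy_le (σ : G → Equiv.Perm V) (ν : ProbabilityMeasure (V → X))
    (μ : ProbabilityMeasure (G → X)) (f : C(G → X, ℝ)) :
    empiricalDiscrepancy σ ν μ f ≤ 2 * ‖f‖ :=
  (integral_mono (integrable_discrepancy_empirical σ μ f _) (integrable_const _)
    fun _ => discrepancy_le _ _ _).trans_eq (by simp)

end

variable {V : ℕ → Type*} [∀ i, Fintype (V i)] [∀ i, Nonempty (V i)]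
  {σ : ∀ i, G → Equiv.Perm (V i)} {ν : ∀ i, ProbabilityMeasure (V i → X)}
  {μ : ProbabilityMeasure (G → X)}

/-- Discrepancies are bounded by `2 * ‖f‖`, so smallness at most vertices gives smallness in mean.
With the converse below, which is Markov's inequality, local convergence becomes a statement about
seminorms, to which Stone-Weierstrass applies. -/
theorem LWConverges.tendsto_localDiscrepancy (h : LWConverges σ ν μ) (f : C(G → X, ℝ)) :
    Tendsto (fun i => localDiscrepancy (σ i) (ν i) μ f) atTop (𝓝 0) := by
  rw [Metric.tendsto_atTop]
  intro ε hε
  have h1 := h _ (setOf_discrepancy_lt_mem_nhds μ f (half_pos hε))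
  have h2 := ((h1.const_sub 1).const_mul (2 * ‖f‖)).const_add (ε / 2)
  simp only [sub_self, mul_zero, add_zero] at h2
  obtain ⟨N, hN⟩ := eventually_atTop.1 (h2.eventually (gt_mem_nhds (half_lt_self hε)))
  refine ⟨N, fun i hi => ?_⟩
  rw [Real.dist_0_eq_abs, abs_of_nonneg (apply_nonneg _ _)]
  refine lt_of_le_of_lt ?_ (hN i hi)
  exact average_le_proportion _
    (fun a => (discrepancy_le _ _ _).trans (by linarith)) (fun a ha => le_of_lt ha)

theorem LWConverges.of_tendsto
    (h : ∀ f : C(G → X, ℝ), Tendsto (fun i => localDiscrepancy (σ i) (ν i) μ f) atTop (𝓝 0)) :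
    LWConverges σ ν μ := by
  intro U hU
  obtain ⟨F, c, hc, hF⟩ := exists_discrepancy_lt_subset hU
  have h1 : Tendsto (fun i => 1 - (∑ f ∈ F, localDiscrepancy (σ i) (ν i) μ f) / c) atTop
      (𝓝 1) := by
    have := ((tendsto_finsetSum F fun f _ => h f).div_const c).const_sub 1
    simpa using this
  refine tendsto_of_tendsto_of_tendsto_of_le_of_le h1 tendsto_const_nhds (fun i => ?_)
    (fun i => proportion_le_one _)
  have h2 : proportion (fun a => ¬ localMarginal (σ i) (ν i) a ∈ U) ≤
      (average fun a => ∑ f ∈ F, discrepancy (localMarginal (σ i) (ν i) a) μ f) / c := by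
    refine proportion_le_average _ hc (fun a => Finset.sum_nonneg fun f _ => apply_nonneg _ _)
      fun a ha => ?_
    by_contra! hlt
    refine ha (hF _ fun f hf => lt_of_le_of_lt ?_ hlt)
    exact Finset.single_le_sum (f := fun f => discrepancy (localMarginal (σ i) (ν i) a) μ f)
      (fun f _ => apply_nonneg _ _) hf
  have h3 : (average fun a => ∑ f ∈ F, discrepancy (localMarginal (σ i) (ν i) a) μ f) =
      ∑ f ∈ F, localDiscrepancy (σ i) (ν i) μ f := by
    simp only [average]
    rw [Finset.sum_comm, Finset.sum_div]
    rfl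
  rw [proportion_not, h3] at h2
  linarith

/-- Convergence of measures of good models is convergence to zero of the mean discrepancy. -/
theorem tendsto_empiricalDiscrepancy
    (h : ∀ U ∈ 𝓝 μ,
      Tendsto (fun i => (ν i : Measure (V i → X)).real (goodModels (σ i) U)) atTop (𝓝 1))
    (f : C(G → X, ℝ)) :
    Tendsto (fun i => empiricalDiscrepancy (σ i) (ν i) μ f) atTop (𝓝 0) := by
  rw [Metric.tendsto_atTop]
  intro ε hε
  have h1 := h _ (setOf_discrepancy_lt_mem_nhds μ f (half_pos hε))
  have h2 := ((h1.const_sub 1).const_mul (2 * ‖f‖)).const_add (ε / 2)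
  simp only [sub_self, mul_zero, add_zero] at h2
  obtain ⟨N, hN⟩ := eventually_atTop.1 (h2.eventually (gt_mem_nhds (half_lt_self hε)))
  refine ⟨N, fun i hi => ?_⟩
  rw [Real.dist_0_eq_abs, abs_of_nonneg (apply_nonneg _ _)]
  refine lt_of_le_of_lt ?_ (hN i hi)
  set A := goodModels (σ i) {m | discrepancy m μ f < ε / 2} with hA
  have hAo : IsOpen A :=
    isOpen_lt (continuous_discrepancy_empirical (σ i) μ f) continuous_const
  rw [← probReal_compl_eq_one_sub hAo.measurableSet, empiricalDiscrepancy_apply]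
  have h3 : ∀ x, discrepancy (empirical (σ i) x) μ f ≤
      ε / 2 + Aᶜ.indicator (fun _ => 2 * ‖f‖) x := by
    intro x
    by_cases hx : x ∈ A
    · simpa [Set.indicator, hx] using le_of_lt hx
    · have := discrepancy_le (empirical (σ i) x) μ f
      simp only [Set.indicator, Set.mem_compl_iff, hx, not_false_eq_true, if_true]
      linarith
  have hint : Integrable (Aᶜ.indicator fun _ => 2 * ‖f‖) (ν i : Measure (V i → X)) :=
    (integrable_const _).indicator hAo.measurableSet.compl
  refine (integral_mono (integrable_discrepancy_empirical (σ i) μ f _)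
    ((integrable_const _).add hint) h3).trans_eq ?_
  simp only [Pi.add_apply]
  rw [integral_add (integrable_const _) hint, integral_indicator_const _ hAo.measurableSet.compl]
  simp [mul_comm]

theorem tendsto_goodModels_of_tendsto
    (h : ∀ f : C(G → X, ℝ), Tendsto (fun i => empiricalDiscrepancy (σ i) (ν i) μ f) atTop (𝓝 0)) :
    ∀ U ∈ 𝓝 μ,
      Tendsto (fun i => (ν i : Measure (V i → X)).real (goodModels (σ i) U)) atTop (𝓝 1) := by
  intro U hU
  obtain ⟨F, c, hc, hF⟩ := exists_discrepancy_lt_subset hU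
  have h1 : Tendsto (fun i => 1 - (∑ f ∈ F, empiricalDiscrepancy (σ i) (ν i) μ f) / c) atTop
      (𝓝 1) := by
    have := ((tendsto_finsetSum F fun f _ => h f).div_const c).const_sub 1
    simpa using this
  refine tendsto_of_tendsto_of_tendsto_of_le_of_le h1 tendsto_const_nhds (fun i => ?_)
    (fun i => measureReal_le_one)
  set u : (V i → X) → ℝ := fun x => ∑ f ∈ F, discrepancy (empirical (σ i) x) μ f with hu
  have hui : Integrable u (ν i : Measure (V i → X)) :=
    integrable_finsetSum _ fun f _ => integrable_discrepancy_empirical (σ i) μ f _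
  have huc : Continuous u :=
    continuous_finsetSum _ fun f _ => continuous_discrepancy_empirical (σ i) μ f
  have hm : MeasurableSet {x | c ≤ u x} := (isClosed_le continuous_const huc).measurableSet
  have h2 : c * (ν i : Measure (V i → X)).real {x | c ≤ u x} ≤
      ∫ x, u x ∂(ν i : Measure (V i → X)) :=
    mul_meas_ge_le_integral_of_nonneg
      (ae_of_all _ fun x => Finset.sum_nonneg fun f _ => apply_nonneg _ _) hui c
  -- `U` is arbitrary, so the set of good models need not be measurable; it is only compared with a
  -- measurable subset.
  have h3 : {x | c ≤ u x}ᶜ ⊆ goodModels (σ i) U := by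
    intro x hx
    refine hF _ fun f hf => lt_of_le_of_lt ?_ (not_le.1 hx)
    exact Finset.single_le_sum (f := fun f => discrepancy (empirical (σ i) x) μ f)
      (fun f _ => apply_nonneg _ _) hf
  have h4 : ∫ x, u x ∂(ν i : Measure (V i → X)) =
      ∑ f ∈ F, empiricalDiscrepancy (σ i) (ν i) μ f :=
    integral_finsetSum _ fun f _ => integrable_discrepancy_empirical (σ i) μ f _
  rw [h4] at h2
  have h5 := measureReal_mono (μ := (ν i : Measure (V i → X))) h3
  rw [probReal_compl_eq_one_sub hm] at h5
  have h6 : (ν i : Measure (V i → X)).real {x | c ≤ u x} ≤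
      (∑ f ∈ F, empiricalDiscrepancy (σ i) (ν i) μ f) / c := by
    rw [le_div_iff₀ hc]; linarith
  linarith

theorem LWConverges.of_separatesPoints (S : Submonoid C(G → X, ℝ))
    (hS : ∀ x y : G → X, x ≠ y → ∃ f ∈ S, f x ≠ f y)
    (h : ∀ f ∈ S, Tendsto (fun i => localDiscrepancy (σ i) (ν i) μ f) atTop (𝓝 0)) :
    LWConverges σ ν μ :=
  .of_tendsto (tendsto_seminorm_of_separatesPoints _ (fun _ _ => localDiscrepancy_le _ _ _ _)
    S hS h)

theorem LEConverges.of_separatesPoints (hLW : LWConverges σ ν μ) (S : Submonoid C(G → X, ℝ))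
    (hS : ∀ x y : G → X, x ≠ y → ∃ f ∈ S, f x ≠ f y)
    (h : ∀ f ∈ S, Tendsto (fun i => empiricalDiscrepancy (σ i) (ν i) μ f) atTop (𝓝 0)) :
    LEConverges σ ν μ :=
  ⟨hLW, tendsto_goodModels_of_tendsto (tendsto_seminorm_of_separatesPoints _
    (fun _ _ => empiricalDiscrepancy_le _ _ _ _) S hS h)⟩

end Characterizations

/-! ### Pairs of independent configurations -/

section Pair

theorem toMeasure_pairMeasure {ι X Y : Type*} [MeasurableSpace X] [MeasurableSpace Y]
    (ν : ProbabilityMeasure (ι → X)) (ν' : ProbabilityMeasure (ι → Y)) :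
    (pairMeasure ν ν' : Measure (ι → X × Y)) =
      ((ν : Measure (ι → X)).prod (ν' : Measure (ι → Y))).map fun p i => (p.1 i, p.2 i) := rfl

theorem measurable_pairing {ι X Y : Type*} [MeasurableSpace X] [MeasurableSpace Y] :
    Measurable fun (p : (ι → X) × (ι → Y)) (i : ι) => (p.1 i, p.2 i) := by fun_prop

theorem toMeasure_coinduced {G H X : Type*} [MeasurableSpace X]
    (μ : ProbabilityMeasure (G → X)) :
    (coinduced H μ : Measure (G × H → X)) =
      (Measure.infinitePi fun _ : H => (μ : Measure (G → X))).map fun y p => y p.2 p.1 := rfl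

theorem measurable_regroup {G H X : Type*} [MeasurableSpace X] :
    Measurable fun (y : H → G → X) (p : G × H) => y p.2 p.1 := by fun_prop

/-- It suffices to compare finite boxes. Integrating out the second factor leaves a product of
functions of distinct coordinates of the first, which are independent. -/
theorem map_pairing_infinitePi {H A B : Type*} [MeasurableSpace A] [MeasurableSpace B]
    (μ : Measure A) (ν : Measure B) [IsProbabilityMeasure μ] [IsProbabilityMeasure ν] :
    ((Measure.infinitePi fun _ : H => μ).prod (Measure.infinitePi fun _ : H => ν)).map
      (fun p h => (p.1 h, p.2 h)) = Measure.infinitePi fun _ : H => μ.prod ν := by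
  refine Measure.eq_infinitePi _ fun s t ht => ?_
  have hms : MeasurableSet (Set.pi (s : Set H) t) :=
    MeasurableSet.pi s.countable_toSet fun i _ => ht i
  rw [Measure.map_apply measurable_pairing hms,
    Measure.prod_apply (measurable_pairing hms)]
  have h1 : ∀ x : H → A, (Measure.infinitePi fun _ : H => ν)
      (Prod.mk x ⁻¹' ((fun (p : (H → A) × (H → B)) h => (p.1 h, p.2 h)) ⁻¹' Set.pi s t)) =
      ∏ h ∈ s, ν (Prod.mk (x h) ⁻¹' t h) := by
    intro x
    rw [← Measure.infinitePi_pi (μ := fun _ : H => ν)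
      (fun i _ => measurable_prodMk_left (ht i))]
    congr 1
  simp only [h1]
  have h2 := ProbabilityTheory.lintegral_prod_eq_prod_lintegral_of_indepFun s
    (fun h (x : H → A) => ν (Prod.mk (x h) ⁻¹' t h))
    (ProbabilityTheory.iIndepFun_infinitePi (P := fun _ : H => μ)
      (X := fun h a => ν (Prod.mk a ⁻¹' t h)) fun h => measurable_measure_prodMk_left (ht h))
    (fun h => (measurable_measure_prodMk_left (ht h)).comp (measurable_pi_apply h))
  rw [h2]
  refine Finset.prod_congr rfl fun h _ => ?_
  rw [Measure.prod_apply (ht h)]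
  exact (measurePreserving_eval_infinitePi (fun _ : H => μ) h).lintegral_comp
    (measurable_measure_prodMk_left (ht h))

/-- Two independent samples of an i.i.d. family form an i.i.d. family of pairs. Applied on both `H`
and `W`, this reduces doubly empirical convergence of product measures to empirical convergence. -/
theorem pairMeasure_coinduced {G H X Y : Type*} [MeasurableSpace X] [MeasurableSpace Y]
    (μ : ProbabilityMeasure (G → X)) (ν : ProbabilityMeasure (G → Y)) :
    pairMeasure (coinduced H μ) (coinduced H ν) = coinduced H (pairMeasure μ ν) := by
  apply Subtype.ext
  change (pairMeasure (coinduced H μ) (coinduced H ν) : Measure (G × H → X × Y)) =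
    (coinduced H (pairMeasure μ ν) : Measure (G × H → X × Y))
  rw [toMeasure_pairMeasure, toMeasure_coinduced, toMeasure_coinduced, toMeasure_coinduced,
    toMeasure_pairMeasure, Measure.map_prod_map _ _ measurable_regroup measurable_regroup,
    Measure.map_map measurable_pairing (measurable_regroup.prodMap measurable_regroup)]
  have : IsProbabilityMeasure (((μ : Measure (G → X)).prod (ν : Measure (G → Y))).map
      fun p i => (p.1 i, p.2 i)) :=
    Measure.isProbabilityMeasure_map measurable_pairing.aemeasurable
  rw [← Measure.infinitePi_map_pi (μ := fun _ : H => (μ : Measure (G → X)).prod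
    (ν : Measure (G → Y))) fun _ => measurable_pairing, ← map_pairing_infinitePi,
    Measure.map_map (by fun_prop) (by fun_prop), Measure.map_map (by fun_prop) (by fun_prop)]
  rfl

theorem localMarginal_pairMeasure {G V X Y : Type*} [MeasurableSpace X] [MeasurableSpace Y]
    (σ : G → Equiv.Perm V) (ν : ProbabilityMeasure (V → X)) (ν' : ProbabilityMeasure (V → Y))
    (a : V) : localMarginal σ (pairMeasure ν ν') a =
      pairMeasure (localMarginal σ ν a) (localMarginal σ ν' a) := by
  apply Subtype.ext
  change ((pairMeasure ν ν' : Measure (V → X × Y)).map (pullbackName σ a)) =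
    (((ν : Measure (V → X)).map (pullbackName σ a)).prod
      ((ν' : Measure (V → Y)).map (pullbackName σ a))).map fun p i => (p.1 i, p.2 i)
  rw [toMeasure_pairMeasure, Measure.map_map (measurable_pullbackName σ a) measurable_pairing,
    Measure.map_prod_map _ _ (measurable_pullbackName σ a) (measurable_pullbackName σ a),
    Measure.map_map measurable_pairing
      ((measurable_pullbackName σ a).prodMap (measurable_pullbackName σ a))]
  rfl

variable {G : Type*} [Countable G] {X : Type*} [MetricSpace X] [CompactSpace X]
  [MeasurableSpace X] [BorelSpace X] {V : ℕ → Type*} [∀ i, Fintype (V i)] [∀ i, Nonempty (V i)]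
  {σ : ∀ i, G → Equiv.Perm (V i)} {ν : ∀ i, ProbabilityMeasure (V i → X)}
  {μ : ProbabilityMeasure (G → X)}

omit [∀ i, Nonempty (V i)] in
-- Squaring a measure is weak* continuous and commutes with taking local marginals.
theorem LWConverges.pair (h : LWConverges σ ν μ) :
    LWConverges σ (fun i => pairMeasure (ν i) (ν i)) (pairMeasure μ μ) := by
  intro U hU
  have hc : Continuous fun m : ProbabilityMeasure (G → X) => pairMeasure m m := by
    have h1 : Continuous fun m : ProbabilityMeasure (G → X) => m.prod m :=
      ProbabilityMeasure.continuous_prod.comp (continuous_id.prodMk continuous_id)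
    have h2 : Continuous fun (p : (G → X) × (G → X)) (i : G) => (p.1 i, p.2 i) := by fun_prop
    exact (ProbabilityMeasure.continuous_map h2).comp h1
  have h3 := h _ (hc.continuousAt.preimage_mem_nhds hU)
  simpa only [localMarginal_pairMeasure, Set.mem_preimage] using h3

end Pair

/-! ### Injectivity of orbit maps over a sofic approximation -/

section Sofic

theorem proportion_or_le {V : Type*} [Fintype V] {p q r : V → Prop} (h : ∀ a, p a → q a ∨ r a) :
    proportion p ≤ proportion q + proportion r := by
  unfold proportion
  rw [← add_div]
  gcongr
  have h1 : {a | p a} ⊆ {a | q a} ∪ {a | r a} := h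
  exact_mod_cast (Set.ncard_le_ncard h1 (Set.toFinite _)).trans (Set.ncard_union_le _ _)

theorem proportion_exists_le {V ι : Type*} [Fintype V] (J : Finset ι) (p : ι → V → Prop) :
    proportion (fun a => ∃ j ∈ J, p j a) ≤ ∑ j ∈ J, proportion (p j) := by
  classical
  induction J using Finset.induction_on with
  | empty => simp [proportion]
  | insert j J hj ih =>
    rw [Finset.sum_insert hj]
    refine (proportion_or_le (q := p j) (r := fun a => ∃ j ∈ J, p j a) ?_).trans
      (add_le_add_right ih _)
    rintro a ⟨k, hk, hka⟩
    rcases Finset.mem_insert.1 hk with rfl | hk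
    · exact Or.inl hka
    · exact Or.inr ⟨k, hk, hka⟩

theorem proportion_nonneg {V : Type*} [Fintype V] (p : V → Prop) : 0 ≤ proportion p := by
  unfold proportion; positivity

variable {H : Type*} [Group H] {W : ℕ → Type*} [∀ i, Fintype (W i)]
  {τ : ∀ i, H → Equiv.Perm (W i)}

theorem IsSoficApprox.comp (hτ : IsSoficApprox τ) {n : ℕ → ℕ} (hn : StrictMono n) :
    IsSoficApprox fun i => τ (n i) :=
  ⟨fun g h => (hτ.mul g h).comp hn.tendsto_atTop, fun g hg =>
    (hτ.free g hg).comp hn.tendsto_atTop⟩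

/-- Over a sofic approximation, the orbit map of almost every vertex is injective on a given
finite set. -/
theorem IsSoficApprox.tendsto_proportion_not_injOn [∀ i, Nonempty (W i)] (hτ : IsSoficApprox τ)
    (K : Finset H) :
    Tendsto (fun i => proportion fun w : W i => ¬ Set.InjOn (fun h => τ i h w) K) atTop (𝓝 0) := by
  classical
  have h1 : ∀ i, (proportion fun w : W i => ¬ Set.InjOn (fun h => τ i h w) K) ≤
      ∑ j ∈ K.offDiag, ((1 - proportion fun w : W i =>
        τ i j.2 (τ i (j.2⁻¹ * j.1) w) = τ i (j.2 * (j.2⁻¹ * j.1)) w) +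
        (1 - proportion fun w : W i => τ i (j.2⁻¹ * j.1) w ≠ w)) := by
    intro i
    refine (proportion_mono ?_).trans ((proportion_exists_le K.offDiag
      (fun j (w : W i) => τ i j.1 w = τ i j.2 w)).trans (Finset.sum_le_sum fun j _ => ?_))
    · intro w hw
      simp only [Set.InjOn, not_forall] at hw
      obtain ⟨h, hh, h', hh', heq, hne⟩ := hw
      exact ⟨(h, h'), Finset.mem_offDiag.2 ⟨hh, hh', hne⟩, heq⟩
    · rw [← proportion_not, ← proportion_not]
      refine proportion_or_le fun w hw => ?_
      -- If `j.1` and `j.2` send `w` to the same vertex and `τ` is multiplicative at `(j.2, j.2⁻¹ *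
      -- j.1)`, cancelling the permutation of `j.2` shows that `j.2⁻¹ * j.1` fixes `w`.
      by_contra! hcon
      obtain ⟨hc1, hc2⟩ := hcon
      rw [mul_inv_cancel_left, hw] at hc1
      exact hc2 ((τ i j.2).injective hc1)
  refine squeeze_zero (fun i => proportion_nonneg _) h1 ?_
  have h2 := tendsto_finsetSum K.offDiag fun (j : H × H) hj =>
    ((hτ.mul j.2 (j.2⁻¹ * j.1)).const_sub 1).add ((hτ.free (j.2⁻¹ * j.1) (by
      intro h0
      exact (Finset.mem_offDiag.1 hj).2.2 (inv_mul_eq_one.1 h0).symm)).const_sub 1)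
  simpa using h2

end Sofic

/-! ### Products of functions of slices -/

section Cylinder

variable {G H : Type*} {X : Type*} [TopologicalSpace X]

/-- The restriction of a configuration on `G × H` to the slice over `h`. -/
def slice (h : H) : C(G × H → X, G → X) :=
  ⟨fun x g => x (g, h), by fun_prop⟩

/-- The product over `h ∈ K` of functions of the slices over `h`. -/
def sliceProd (K : Finset H) (a : H → C(G → X, ℝ)) : C(G × H → X, ℝ) :=
  ∏ h ∈ K, (a h).comp (slice h)

theorem sliceProd_apply (K : Finset H) (a : H → C(G → X, ℝ)) (x : G × H → X) :
    sliceProd K a x = ∏ h ∈ K, a h fun g => x (g, h) := by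
  rw [sliceProd, ContinuousMap.prod_apply]
  rfl

/-- The multiplicative monoid of products of functions of finitely many slices. -/
def sliceProds (G H X : Type*) [TopologicalSpace X] : Submonoid C(G × H → X, ℝ) where
  carrier := {f | ∃ K a, f = sliceProd K a}
  one_mem' := ⟨∅, 1, by simp [sliceProd]⟩
  mul_mem' := by
    classical
    rintro _ _ ⟨K, a, rfl⟩ ⟨K', a', rfl⟩
    -- Each family is extended by the constant `1`, so that both products run over `K ∪ K'`.
    refine ⟨K ∪ K', fun h => (if h ∈ K then a h else 1) * if h ∈ K' then a' h else 1, ?_⟩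
    ext x
    simp only [ContinuousMap.mul_apply, sliceProd_apply, Finset.prod_mul_distrib]
    congr 1
    · rw [← Finset.prod_subset Finset.subset_union_left (fun h _ hK => by simp [hK])]
      exact Finset.prod_congr rfl fun h hh => by simp [hh]
    · rw [← Finset.prod_subset Finset.subset_union_right (fun h _ hK => by simp [hK])]
      exact Finset.prod_congr rfl fun h hh => by simp [hh]

theorem sliceProds_separatesPoints {X : Type*} [MetricSpace X] (x y : G × H → X) (hxy : x ≠ y) :
    ∃ f ∈ sliceProds G H X, f x ≠ f y := by
  obtain ⟨⟨g, h⟩, hgh⟩ := Function.ne_iff.1 hxy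
  refine ⟨_, ⟨{h}, fun _ => ⟨fun z => dist (z g) (x (g, h)), by fun_prop⟩, rfl⟩, ?_⟩
  simpa [sliceProd_apply, eq_comm] using hgh

end Cylinder

/-- One factor is replaced at a time; `1 ≤ M` lets the same power of `M` bound all partial products.
-/
theorem abs_prod_sub_prod_le {ι : Type*} (K : Finset ι) (x y : ι → ℝ) {M : ℝ} (hM : 1 ≤ M)
    (hx : ∀ i, |x i| ≤ M) (hy : ∀ i, |y i| ≤ M) :
    |∏ i ∈ K, x i - ∏ i ∈ K, y i| ≤ M ^ K.card * ∑ i ∈ K, |x i - y i| := by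
  classical
  have hM0 : 0 ≤ M := by linarith
  induction K using Finset.induction_on with
  | empty => simp
  | insert j K hj ih =>
    rw [Finset.prod_insert hj, Finset.prod_insert hj, Finset.sum_insert hj,
      Finset.card_insert_of_notMem hj]
    have h1 : |∏ i ∈ K, y i| ≤ M ^ K.card := by
      rw [Finset.abs_prod]
      exact (Finset.prod_le_prod (fun _ _ => abs_nonneg _) fun i _ => hy i).trans_eq (by simp)
    have h2 : x j * ∏ i ∈ K, x i - y j * ∏ i ∈ K, y i =
        x j * (∏ i ∈ K, x i - ∏ i ∈ K, y i) + (x j - y j) * ∏ i ∈ K, y i := by ring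
    have h4 : M ^ K.card ≤ M ^ (K.card + 1) := pow_le_pow_right₀ hM (Nat.le_succ _)
    calc _ ≤ |x j| * |∏ i ∈ K, x i - ∏ i ∈ K, y i| + |x j - y j| * |∏ i ∈ K, y i| := by
          rw [h2, ← abs_mul, ← abs_mul]; exact abs_add_le _ _
      _ ≤ M * (M ^ K.card * ∑ i ∈ K, |x i - y i|) + |x j - y j| * M ^ (K.card + 1) := by
          gcongr
          · exact hx j
          · exact h1.trans h4
      _ = _ := by ring

/-! ### Independence of distinct coordinates -/

section Integrals

variable {A : Type*} [MeasurableSpace A]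

theorem integral_infinitePi_eval {H : Type*} (μ : Measure A) [IsProbabilityMeasure μ] (h : H)
    {f : A → ℝ} (hf : StronglyMeasurable f) :
    ∫ y, f (y h) ∂(Measure.infinitePi fun _ : H => μ) = ∫ a, f a ∂μ := by
  conv_rhs => rw [← (measurePreserving_eval_infinitePi (fun _ : H => μ) h).map_eq]
  rw [integral_map (measurable_pi_apply h).aemeasurable hf.aestronglyMeasurable]

/-- Coordinates at distinct indices are independent. The reindexing `e` will be an orbit map `h ↦ τ
h w`, and this is where its injectivity is needed. -/
theorem integral_infinitePi_prod {H J : Type*} (μ : Measure A) [IsProbabilityMeasure μ]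
    (K : Finset J) {e : J → H} (he : Set.InjOn e K) {f : J → A → ℝ}
    (hf : ∀ j, StronglyMeasurable (f j)) :
    ∫ y, ∏ j ∈ K, f j (y (e j)) ∂(Measure.infinitePi fun _ : H => μ) =
      ∏ j ∈ K, ∫ a, f j a ∂μ := by
  have h1 : ProbabilityTheory.iIndepFun (fun (j : K) (y : H → A) => y (e j))
      (Measure.infinitePi fun _ : H => μ) :=
    (ProbabilityTheory.iIndepFun_infinitePi (P := fun _ : H => μ) (X := fun _ a => a)
      fun _ => measurable_id).precomp (g := fun j : K => e j) (Set.injOn_iff_injective.1 he)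
  have h2 := h1.integral_fun_prod_comp (f := fun j : K => f j)
    (fun j => (measurable_pi_apply _).aemeasurable) (fun j => (hf j).aestronglyMeasurable)
  simp only [integral_infinitePi_eval μ _ (hf _)] at h2
  rw [← Finset.prod_coe_sort K fun j => ∫ a, f j a ∂μ, ← h2]
  refine integral_congr_ae (ae_of_all _ fun y => ?_)
  exact (Finset.prod_coe_sort K fun j => f j (y (e j))).symm

end Integrals

theorem integral_coinduced {G H X : Type*} [MeasurableSpace X] (μ : ProbabilityMeasure (G → X))
    {f : (G × H → X) → ℝ} (hf : StronglyMeasurable f) :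
    ∫ x, f x ∂(coinduced H μ : Measure (G × H → X)) =
      ∫ y, f (fun p => y p.2 p.1) ∂(Measure.infinitePi fun _ : H => (μ : Measure (G → X))) := by
  rw [toMeasure_coinduced, integral_map measurable_regroup.aemeasurable hf.aestronglyMeasurable]

/-! ### Local convergence of product measures -/

section Coinduced

variable {G : Type*} [Countable G] {H : Type*} [Countable H] {X : Type*} [MetricSpace X]
  [CompactSpace X] [MeasurableSpace X] [BorelSpace X]

theorem integral_sliceProd (μ : ProbabilityMeasure (G → X)) (K : Finset H)
    (a : H → C(G → X, ℝ)) :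
    ∫ x, sliceProd K a x ∂(coinduced H μ : Measure (G × H → X)) =
      ∏ h ∈ K, ∫ y, a h y ∂(μ : Measure (G → X)) := by
  rw [integral_coinduced μ (sliceProd K a).continuous.stronglyMeasurable]
  simp only [sliceProd_apply]
  exact integral_infinitePi_prod _ K (e := id) (Set.injOn_id _)
    fun h => (a h).continuous.stronglyMeasurable

section

variable {V W : Type*} [Fintype V] [Fintype W]

/-- The product of two maps into permutation groups. -/
def prodPerm (σ : G → Equiv.Perm V) (τ : H → Equiv.Perm W) : G × H → Equiv.Perm (V × W) :=
  fun p => (σ p.1).prodCongr (τ p.2)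

omit [Countable G] [Countable H] [CompactSpace X] [MeasurableSpace X] [BorelSpace X]
  [Fintype V] [Fintype W] in
theorem sliceProd_pullbackName (σ : G → Equiv.Perm V) (τ : H → Equiv.Perm W) (K : Finset H)
    (a : H → C(G → X, ℝ)) (v : V) (w : W) (y : W → V → X) :
    sliceProd K a (pullbackName (prodPerm σ τ) (v, w) fun p => y p.2 p.1) =
      ∏ h ∈ K, a h (pullbackName σ v (y (τ h w))) := by
  rw [sliceProd_apply]
  rfl

omit [Countable G] [Countable H] in
theorem integral_sliceProd_pullbackName (σ : G → Equiv.Perm V) (τ : H → Equiv.Perm W)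
    (ν : ProbabilityMeasure (V → X)) (K : Finset H) (a : H → C(G → X, ℝ)) (v : V) (w : W)
    (hw : Set.InjOn (fun h => τ h w) K) :
    ∫ x, sliceProd K a (pullbackName (prodPerm σ τ) (v, w) x)
        ∂(coinduced W ν : Measure (V × W → X)) =
      ∏ h ∈ K, ∫ x, a h (pullbackName σ v x) ∂(ν : Measure (V → X)) := by
  have hc : Continuous fun x : V × W → X =>
      sliceProd K a (pullbackName (prodPerm σ τ) (v, w) x) :=
    (sliceProd K a).continuous.comp (continuous_pullbackName _ _)
  rw [integral_coinduced ν hc.stronglyMeasurable]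
  simp only [sliceProd_pullbackName]
  exact integral_infinitePi_prod _ K (e := fun h => τ h w) hw
    fun h => ((a h).continuous.comp (continuous_pullbackName σ v)).stronglyMeasurable

/-- Where the orbit map of `w` is injective on `K`, both integrals factor over `K` and the factors
are compared one by one. The other `w` are charged the trivial bound. -/
theorem localDiscrepancy_sliceProd_le [Nonempty V] [Nonempty W] (σ : G → Equiv.Perm V)
    (τ : H → Equiv.Perm W) (ν : ProbabilityMeasure (V → X)) (μ : ProbabilityMeasure (G → X))
    (K : Finset H) (a : H → C(G → X, ℝ)) {M : ℝ} (hM : 1 ≤ M) (ha : ∀ h ∈ K, ‖a h‖ ≤ M) :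
    localDiscrepancy (prodPerm σ τ) (coinduced W ν) (coinduced H μ) (sliceProd K a) ≤
      M ^ K.card * ∑ h ∈ K, localDiscrepancy σ ν μ (a h) +
        2 * ‖sliceProd K a‖ * proportion fun w => ¬ Set.InjOn (fun h => τ h w) K := by
  classical
  -- Only `a h` with `h ∈ K` matter; setting the others to zero makes the bound global.
  wlog ha' : ∀ h, ‖a h‖ ≤ M generalizing a
  · have h1 : sliceProd K (fun h => if h ∈ K then a h else 0) = sliceProd K a := by
      ext x
      simp only [sliceProd_apply]
      exact Finset.prod_congr rfl fun h hh => by simp [hh]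
    have h2 := this (fun h => if h ∈ K then a h else 0) (fun h hh => by simpa [hh] using ha h hh)
      (fun h => by
        split_ifs with hh
        · exact ha h hh
        · simpa using zero_le_one.trans hM)
    rw [h1] at h2
    refine h2.trans_eq ?_
    congr 2
    exact Finset.sum_congr rfl fun h hh => by simp [hh]
  rw [proportion_eq_average]
  change _ ≤ _ + _ * average fun w => if ¬ Set.InjOn (fun h => τ h w) K then (1 : ℝ) else 0
  have h0 : M ^ K.card * ∑ h ∈ K, localDiscrepancy σ ν μ (a h) =
      average fun v => M ^ K.card * ∑ h ∈ K,
        |∫ x, a h (pullbackName σ v x) ∂(ν : Measure (V → X)) -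
          ∫ y, a h y ∂(μ : Measure (G → X))| := by
    rw [average_const_mul]
    congr 1
    simp only [localDiscrepancy_apply, average]
    rw [Finset.sum_comm, Finset.sum_div]
  rw [h0, ← average_const_mul, localDiscrepancy_apply, average_prod, ← average_const (V := V)
    (average fun w => 2 * ‖sliceProd K a‖ *
      if ¬ Set.InjOn (fun h => τ h w) K then (1 : ℝ) else 0), ← average_add]
  refine average_mono fun v => ?_
  rw [← average_const (V := W) (M ^ K.card * _), ← average_add]
  refine average_mono fun w => ?_
  by_cases hw : Set.InjOn (fun h => τ h w) K
  · simp only [hw, not_true_eq_false, if_false, mul_zero, add_zero]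
    rw [integral_sliceProd_pullbackName σ τ ν K a v w hw, integral_sliceProd]
    refine abs_prod_sub_prod_le K _ _ hM (fun h => ?_) fun h => ?_
    · exact (abs_integral_le_norm (ν : Measure (V → X)) ((a h).comp
        ⟨_, continuous_pullbackName σ v⟩)).trans
        (((ContinuousMap.norm_le ((a h).comp _) (norm_nonneg (a h))).2 fun x =>
          (a h).norm_coe_le_norm _).trans (ha' h))
    · exact (abs_integral_le_norm (μ : Measure (G → X)) (a h)).trans (ha' h)
  · simp only [hw, not_false_eq_true, if_true, mul_one]
    refine le_add_of_nonneg_of_le (by positivity) ?_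
    have := discrepancy_le (localMarginal (prodPerm σ τ) (coinduced W ν) (v, w)) (coinduced H μ)
      (sliceProd K a)
    rwa [discrepancy_apply, integral_localMarginal _ _ _
      (sliceProd K a).continuous.stronglyMeasurable] at this

end

end Coinduced

/-! ### Empirical convergence of product measures -/

section Coinduced

variable {G : Type*} [Countable G] {H : Type*} {X : Type*} [MetricSpace X]
  [CompactSpace X] [MeasurableSpace X] [BorelSpace X]

/-- The variance of `|u|` is nonnegative. -/
theorem sq_integral_abs_le {Ω : Type*} [MeasurableSpace Ω] (m : Measure Ω)
    [IsProbabilityMeasure m] {u : Ω → ℝ} (hu : Integrable u m)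
    (hu2 : Integrable (fun x => u x ^ 2) m) : (∫ x, |u x| ∂m) ^ 2 ≤ ∫ x, u x ^ 2 ∂m := by
  set t := ∫ x, |u x| ∂m with ht
  have h1 : 0 ≤ ∫ x, (|u x| - t) ^ 2 ∂m := integral_nonneg fun x => sq_nonneg _
  have h2 : ∀ x, (|u x| - t) ^ 2 = u x ^ 2 - (2 * t) * |u x| + t ^ 2 := by
    intro x
    rw [sub_sq, sq_abs]; ring
  simp only [h2] at h1
  have h3 : Integrable (fun x => u x ^ 2 - (2 * t) * |u x|) m := hu2.sub (hu.abs.const_mul _)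
  rw [integral_add h3 (integrable_const _),
    integral_sub hu2 (hu.abs.const_mul _), integral_const_mul, ← ht] at h1
  simp only [integral_const, probReal_univ, one_smul] at h1
  nlinarith

section

variable {V W : Type*} [Fintype V] [Fintype W]

omit [Countable G] in
/-- The second moment bound: averages of functions of few independent slices concentrate. -/
theorem integral_average_sub_sq_le [Nonempty V] [Nonempty W] (σ : G → Equiv.Perm V)
    (τ : H → Equiv.Perm W) (ν : Measure (V → X)) [IsProbabilityMeasure ν] (K : Finset H)
    (a : H → C(G → X, ℝ)) {B : ℝ} (Y : W → (W → V → X) → ℝ)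
    (hY : ∀ w y, Y w y = average fun v => ∏ h ∈ K, a h (pullbackName σ v (y (τ h w))))
    (hB : ∀ w y, |Y w y| ≤ B) :
    ∫ y, (average fun w => Y w y - ∫ z, Y w z ∂(Measure.infinitePi fun _ : W => ν)) ^ 2
      ∂(Measure.infinitePi fun _ : W => ν) ≤ (2 * B) ^ 2 * K.card ^ 2 / Fintype.card W := by
  classical
  set P := Measure.infinitePi fun _ : W => ν with hP
  have hYc : ∀ w, Continuous (Y w) := by
    intro w
    rw [funext (hY w)]
    unfold average
    refine (continuous_finsetSum _ fun v _ => continuous_finsetProd _ fun h _ => ?_).div_const _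
    exact (a h).continuous.comp ((continuous_pullbackName σ v).comp (continuous_apply _))
  have hint : ∀ {f : (W → V → X) → ℝ}, Continuous f → Integrable f P :=
    fun {f} hf => integrable_continuousMap P ⟨f, hf⟩
  set Z : W → (W → V → X) → ℝ := fun w y => Y w y - ∫ z, Y w z ∂P with hZ
  have hZc : ∀ w, Continuous (Z w) := fun w => (hYc w).sub continuous_const
  have hB0 : 0 ≤ B := by
    obtain ⟨y⟩ := nonempty_of_isProbabilityMeasure P
    exact (abs_nonneg _).trans (hB (Classical.arbitrary W) y)
  have hZB : ∀ w y, |Z w y| ≤ 2 * B := by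
    intro w y
    have h1 : |∫ z, Y w z ∂P| ≤ B := by
      have := norm_integral_le_of_norm_le_const (f := Y w) (μ := P) (ae_of_all _ fun z => hB w z)
      simpa using this
    have h2 := abs_sub (Y w y) (∫ z, Y w z ∂P)
    have h3 := hB w y
    simp only [hZ]
    linarith
  have hZ0 : ∀ w, ∫ y, Z w y ∂P = 0 := by
    intro w
    simp only [hZ]
    rw [integral_sub (hint (hYc w)) (integrable_const _)]
    simp
  -- `Z w` depends only on the slices in `S w`; disjoint sets of slices give independent, hence
  -- orthogonal, centred variables.
  let S : W → Finset W := fun w => K.image fun h => τ h w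
  have hindep : ∀ w w', Disjoint (S w) (S w') → ∫ y, Z w y * Z w' y ∂P = 0 := by
    intro w w' hd
    have h1 := (ProbabilityTheory.iIndepFun_infinitePi (P := fun _ : W => ν) (X := fun _ b => b)
      fun _ => measurable_id).indepFun_finset (S w) (S w') hd (fun i => measurable_pi_apply i)
    have hfac : ∀ u : W, ∃ g : (S u → V → X) → ℝ, Measurable g ∧
        ∀ y : W → V → X, g (fun i => y i) = Z u y := by
      intro u
      refine ⟨fun z => (average fun v => ∏ h : K, a h (pullbackName σ v
        (z ⟨τ h u, Finset.mem_image_of_mem _ h.2⟩))) - ∫ z, Y u z ∂P, ?_, fun y => ?_⟩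
      · refine Continuous.measurable (Continuous.sub ?_ continuous_const)
        unfold average
        refine (continuous_finsetSum _ fun v _ =>
          continuous_finsetProd _ fun h _ => ?_).div_const _
        exact (a h).continuous.comp ((continuous_pullbackName σ v).comp (continuous_apply _))
      · simp only [hZ, hY]
        congr 2
        ext v
        exact Finset.prod_coe_sort K fun h => a h (pullbackName σ v (y (τ h u)))
    obtain ⟨g, hg, hgZ⟩ := hfac w
    obtain ⟨g', hg', hgZ'⟩ := hfac w'
    have h2 := h1.comp hg hg'
    have h3 := h2.integral_fun_mul_eq_mul_integral
      (hg.comp (by fun_prop)).aestronglyMeasurable (hg'.comp (by fun_prop)).aestronglyMeasurable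
    simp only [Function.comp_apply, hgZ, hgZ'] at h3
    rw [← hP, hZ0, zero_mul] at h3
    exact h3
  -- If `S w` and `S w'` meet, then `τ h w = τ h' w'` for some `h, h' ∈ K`, and the pair `(h, h')`
  -- determines `w'`.
  have hcard : ∀ w, (Finset.univ.filter fun w' => ¬ Disjoint (S w) (S w')).card ≤ K.card ^ 2 := by
    intro w
    have h1 : (Finset.univ.filter fun w' => ¬ Disjoint (S w) (S w')) ⊆
        (K ×ˢ K).image fun p => (τ p.2).symm (τ p.1 w) := by
      intro w' hw'
      obtain ⟨u, hu, hu'⟩ := Finset.not_disjoint_iff.1 (Finset.mem_filter.1 hw').2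
      obtain ⟨h, hh, rfl⟩ := Finset.mem_image.1 hu
      obtain ⟨h', hh', he⟩ := Finset.mem_image.1 hu'
      refine Finset.mem_image.2 ⟨(h, h'), Finset.mk_mem_product hh hh', ?_⟩
      simp [← he]
    calc _ ≤ _ := Finset.card_le_card h1
      _ ≤ _ := Finset.card_image_le
      _ = _ := by rw [Finset.card_product, sq]
  have hexp : ∀ y, (average fun w => Z w y) ^ 2 = average fun w => average fun w' =>
      Z w y * Z w' y := by
    intro y
    simp only [sq, average_const_mul]
    simp only [mul_comm (Z _ y), average_const_mul]
  have hle : ∀ w w', ∫ y, Z w y * Z w' y ∂P ≤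
      if ¬ Disjoint (S w) (S w') then (2 * B) ^ 2 else 0 := by
    intro w w'
    split_ifs with hd
    · exact (hindep w w' hd).le
    · have h1 : ∀ y, Z w y * Z w' y ≤ (2 * B) ^ 2 := by
        intro y
        refine (le_abs_self _).trans ?_
        rw [abs_mul, sq]
        exact mul_le_mul (hZB w y) (hZB w' y) (abs_nonneg _) (by linarith)
      exact (integral_mono (hint ((hZc w).mul (hZc w'))) (integrable_const _) h1).trans_eq
        (by simp)
  change ∫ y, (average fun w => Z w y) ^ 2 ∂P ≤ _
  simp only [hexp]
  rw [integral_average]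
  swap
  · intro w
    unfold average
    exact (integrable_finsetSum _ fun w' _ => hint ((hZc w).mul (hZc w'))).div_const _
  rw [← average_const (V := W) ((2 * B) ^ 2 * K.card ^ 2 / Fintype.card W)]
  refine average_mono fun w => ?_
  have hZZ : ∀ w', Integrable (fun y => Z w y * Z w' y) P := fun w' =>
    hint ((hZc w).mul (hZc w'))
  rw [integral_average _ hZZ]
  refine (average_mono (hle w)).trans ?_
  rw [average]
  gcongr
  rw [← Finset.sum_filter, Finset.sum_const, nsmul_eq_mul, mul_comm]
  gcongr
  exact_mod_cast hcard w

variable [Countable H]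

/-- Split at the mean of the empirical average. The fluctuation is controlled by the second moment
bound, and the distance of the mean from the limit integral by the local discrepancy. -/
theorem empiricalDiscrepancy_sliceProd_le [Nonempty V] [Nonempty W] (σ : G → Equiv.Perm V)
    (τ : H → Equiv.Perm W) (ν : ProbabilityMeasure (V → X)) (μ : ProbabilityMeasure (G → X))
    (K : Finset H) (a : H → C(G → X, ℝ)) :
    empiricalDiscrepancy (prodPerm σ τ) (coinduced W ν) (coinduced H μ) (sliceProd K a) ≤
      √((2 * ‖sliceProd K a‖) ^ 2 * K.card ^ 2 / Fintype.card W) +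
        localDiscrepancy (prodPerm σ τ) (coinduced W ν) (coinduced H μ) (sliceProd K a) := by
  set f := sliceProd K a with hf
  set P := Measure.infinitePi fun _ : W => (ν : Measure (V → X)) with hP
  set c := ∫ y, f y ∂(coinduced H μ : Measure (G × H → X)) with hc
  let Y : W → (W → V → X) → ℝ := fun w y =>
    average fun v => f (pullbackName (prodPerm σ τ) (v, w) fun p => y p.2 p.1)
  have hfc : ∀ v w, Continuous fun y : W → V → X =>
      f (pullbackName (prodPerm σ τ) (v, w) fun p => y p.2 p.1) := fun v w =>
    f.continuous.comp ((continuous_pullbackName _ _).comp (by fun_prop))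
  have hint : ∀ {u : (W → V → X) → ℝ}, Continuous u → Integrable u P :=
    fun {u} hu => integrable_continuousMap P ⟨u, hu⟩
  have hYc : ∀ w, Continuous (Y w) := fun w =>
    (continuous_finsetSum _ fun v _ => hfc v w).div_const _
  have hYB : ∀ w y, |Y w y| ≤ ‖f‖ := fun w y =>
    (abs_average_le _).trans ((average_mono fun v => f.norm_coe_le_norm _).trans_eq
      (average_const _))
  have h1 := integral_average_sub_sq_le σ τ (ν : Measure (V → X)) K a Y
    (fun w y => by simp only [Y, hf, sliceProd_pullbackName]) hYB
  set u : (W → V → X) → ℝ := fun y => average fun w => Y w y - ∫ z, Y w z ∂P with hu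
  have huc : Continuous u :=
    (continuous_finsetSum _ fun w _ => (hYc w).sub continuous_const).div_const _
  have h2 : ∫ y, |u y| ∂P ≤ √((2 * ‖f‖) ^ 2 * K.card ^ 2 / Fintype.card W) :=
    Real.le_sqrt_of_sq_le
      ((sq_integral_abs_le P (hint huc) (hint (huc.pow 2))).trans h1)
  have h3 : |(average fun w => ∫ z, Y w z ∂P) - c| ≤
      localDiscrepancy (prodPerm σ τ) (coinduced W ν) (coinduced H μ) f := by
    rw [localDiscrepancy_apply, average_prod, average_comm, ← average_const (V := W) c,
      ← average_sub]
    refine (abs_average_le _).trans (average_mono fun w => ?_)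
    have h4 : ∫ z, Y w z ∂P - c = average fun v =>
        ∫ x, f (pullbackName (prodPerm σ τ) (v, w) x) ∂(coinduced W ν : Measure (V × W → X)) -
          c := by
      rw [integral_average _ fun v => hint (hfc v w), average_sub, average_const]
      congr 2
      ext v
      exact (integral_coinduced ν
        (f.continuous.comp (continuous_pullbackName _ _)).stronglyMeasurable).symm
    rw [h4]
    exact abs_average_le _
  rw [empiricalDiscrepancy_apply, integral_coinduced ν
    (continuous_discrepancy_empirical _ _ f).stronglyMeasurable]
  have h4 : ∀ y : W → V → X, discrepancy (empirical (prodPerm σ τ) fun p => y p.2 p.1)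
      (coinduced H μ) f ≤ |u y| + |(average fun w => ∫ z, Y w z ∂P) - c| := by
    intro y
    rw [discrepancy_empirical, average_prod, average_comm]
    have h5 : u y = (average fun w => Y w y) - average fun w => ∫ z, Y w z ∂P := average_sub _ _
    rw [h5]
    exact abs_sub_le _ _ _
  have h6 : Continuous fun y : W → V → X => discrepancy
      (empirical (prodPerm σ τ) fun p => y p.2 p.1) (coinduced H μ) f :=
    (continuous_discrepancy_empirical (prodPerm σ τ) (coinduced H μ) f).comp
      (by fun_prop : Continuous fun (y : W → V → X) (p : V × W) => y p.2 p.1)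
  refine (integral_mono (hint h6) ((hint huc.abs).add (integrable_const _)) h4).trans ?_
  simp only [Pi.add_apply]
  rw [integral_add (hint huc.abs) (integrable_const _)]
  simp only [integral_const, probReal_univ, one_smul]
  exact add_le_add h2 h3

end

variable [Countable H] [Group H]
  {V W : ℕ → Type*} [∀ i, Fintype (V i)] [∀ i, Nonempty (V i)]
  [∀ i, Fintype (W i)] [∀ i, Nonempty (W i)]
  {σ : ∀ i, G → Equiv.Perm (V i)} {τ : ∀ i, H → Equiv.Perm (W i)}
  {ν : ∀ i, ProbabilityMeasure (V i → X)} {μ : ProbabilityMeasure (G → X)}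

theorem LWConverges.coinduced (h : LWConverges σ ν μ) (hτ : IsSoficApprox τ) :
    LWConverges (fun i => prodPerm (σ i) (τ i)) (fun i => coinduced (W i) (ν i))
      (coinduced H μ) := by
  refine .of_separatesPoints (sliceProds G H X) sliceProds_separatesPoints ?_
  rintro _ ⟨K, a, rfl⟩
  obtain ⟨M, hM⟩ : ∃ M, ∀ h ∈ K, ‖a h‖ ≤ M :=
    ⟨∑ h ∈ K, ‖a h‖, fun h hh => Finset.single_le_sum (f := fun h => ‖a h‖)
      (fun _ _ => norm_nonneg _) hh⟩
  refine squeeze_zero (fun i => apply_nonneg _ _) (fun i =>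
    localDiscrepancy_sliceProd_le (σ i) (τ i) (ν i) μ K a (le_max_left 1 M)
      fun h hh => (hM h hh).trans (le_max_right 1 M)) ?_
  have h1 := (tendsto_finsetSum K fun k _ => h.tendsto_localDiscrepancy (a k)).const_mul
    (max 1 M ^ K.card)
  have h2 := (hτ.tendsto_proportion_not_injOn K).const_mul (2 * ‖sliceProd K a‖)
  simpa using h1.add h2

theorem LWConverges.leConverges_coinduced (h : LWConverges σ ν μ) (hτ : IsSoficApprox τ)
    (hW : Tendsto (fun i => Fintype.card (W i)) atTop atTop) :
    LEConverges (fun i => prodPerm (σ i) (τ i)) (fun i => SoficEntropy.coinduced (W i) (ν i))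
      (SoficEntropy.coinduced H μ) := by
  have hLW := h.coinduced hτ
  refine .of_separatesPoints hLW (sliceProds G H X) sliceProds_separatesPoints ?_
  rintro _ ⟨K, a, rfl⟩
  refine squeeze_zero (fun i => apply_nonneg _ _) (fun i =>
    empiricalDiscrepancy_sliceProd_le (σ i) (τ i) (ν i) μ K a) ?_
  have h1 := ((tendsto_natCast_atTop_atTop (R := ℝ)).comp hW).const_div_atTop
    ((2 * ‖sliceProd K a‖) ^ 2 * K.card ^ 2)
  have h2 := h1.sqrt.add (hLW.tendsto_localDiscrepancy (sliceProd K a))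
  simpa using h2

/-- If `|W i| → ∞`, then taking product measures turns local weak* convergence into local and
doubly empirical convergence. -/
theorem LWConverges.ldeConverges_coinduced (h : LWConverges σ ν μ) (hτ : IsSoficApprox τ)
    (hW : Tendsto (fun i => Fintype.card (W i)) atTop atTop) :
    LDEConverges (fun i => prodPerm (σ i) (τ i)) (fun i => SoficEntropy.coinduced (W i) (ν i))
      (SoficEntropy.coinduced H μ) := by
  unfold LDEConverges
  simp only [pairMeasure_coinduced]
  exact h.pair.leConverges_coinduced hτ hW

end Coinduced

/-! ### Gibbs' inequality and entropy of finitely valued functions -/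

section Gibbs

variable {B : Type*} [Fintype B]

/-- Gibbs' inequality. -/
theorem sum_negMulLog_le {p q : B → ℝ} (hp : ∀ b, 0 ≤ p b) (hp1 : ∑ b, p b = 1)
    (hq : ∀ b, 0 ≤ q b) (hq1 : ∑ b, q b ≤ 1) (hpq : ∀ b, p b ≠ 0 → q b ≠ 0) :
    ∑ b, Real.negMulLog (p b) ≤ ∑ b, p b * -Real.log (q b) := by
  have h1 : ∀ b, Real.negMulLog (p b) - p b * -Real.log (q b) ≤ q b - p b := by
    intro b
    rcases (hp b).eq_or_lt with h0 | h0
    · simpa [← h0, Real.negMulLog] using hq b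
    -- Since `Real.log 0 = 0`, a zero of `q` where `p` is positive would contribute nothing instead
    -- of `+∞`; `hpq` excludes this.
    · have hqb : 0 < q b := (hq b).lt_of_ne' (hpq b h0.ne')
      have h2 := Real.log_le_sub_one_of_pos (div_pos hqb h0)
      rw [Real.log_div hqb.ne' h0.ne'] at h2
      have h3 := mul_le_mul_of_nonneg_left h2 h0.le
      rw [mul_sub_one, mul_div_cancel₀ _ h0.ne'] at h3
      simp only [Real.negMulLog]
      linarith
  have h4 := Finset.sum_le_sum fun b (_ : b ∈ Finset.univ) => h1 b
  rw [Finset.sum_sub_distrib, Finset.sum_sub_distrib, hp1] at h4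
  linarith

variable {Ω : Type*} [MeasurableSpace Ω]

/-- The Shannon entropy of a finitely valued function. -/
def labelEntropy (ν : Measure Ω) (κ : Ω → B) : ℝ :=
  ∑ᶠ b, Real.negMulLog (ν.real (κ ⁻¹' {b}))

omit [Fintype B] in
theorem labelEntropy_nonneg (ν : Measure Ω) [IsProbabilityMeasure ν] (κ : Ω → B) :
    0 ≤ labelEntropy ν κ :=
  finsum_nonneg fun _ => Real.negMulLog_nonneg measureReal_nonneg measureReal_le_one

omit [Fintype B] in
theorem stronglyMeasurable_comp_label [Finite B] {κ : Ω → B} (hκ : ∀ b, MeasurableSet (κ ⁻¹' {b}))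
    (φ : B → ℝ) : StronglyMeasurable fun x => φ (κ x) := by
  let _ : MeasurableSpace B := ⊤
  have h1 : Measurable κ := measurable_to_countable' hκ
  exact ((measurable_of_finite φ).comp h1).stronglyMeasurable

omit [Fintype B] in
theorem integrable_comp_label [Finite B] {κ : Ω → B} (hκ : ∀ b, MeasurableSet (κ ⁻¹' {b}))
    (ν : Measure Ω) [IsFiniteMeasure ν] (φ : B → ℝ) : Integrable (fun x => φ (κ x)) ν := by
  have := Fintype.ofFinite B
  exact Integrable.of_bound (stronglyMeasurable_comp_label hκ φ).aestronglyMeasurable (∑ b, |φ b|)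
    (ae_of_all _ fun x => Finset.single_le_sum (f := fun b => |φ b|)
      (fun _ _ => abs_nonneg _) (Finset.mem_univ (κ x)))

theorem integral_comp_label {κ : Ω → B} (hκ : ∀ b, MeasurableSet (κ ⁻¹' {b}))
    (ν : Measure Ω) [IsFiniteMeasure ν] (φ : B → ℝ) :
    ∫ x, φ (κ x) ∂ν = ∑ b, ν.real (κ ⁻¹' {b}) * φ b := by
  classical
  have h1 : ∀ x, φ (κ x) = ∑ b, (κ ⁻¹' {b}).indicator (fun _ => φ b) x := by
    intro x
    simp [Set.indicator_apply]
  simp only [h1]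
  rw [integral_finsetSum _ fun b _ => (integrable_const _).indicator (hκ b)]
  exact Finset.sum_congr rfl fun b _ => by rw [integral_indicator_const _ (hκ b), smul_eq_mul]

theorem sum_measureReal_label {κ : Ω → B} (hκ : ∀ b, MeasurableSet (κ ⁻¹' {b}))
    (ν : Measure Ω) [IsProbabilityMeasure ν] : ∑ b, ν.real (κ ⁻¹' {b}) = 1 := by
  simpa using (integral_comp_label hκ ν fun _ => (1 : ℝ)).symm

omit [Fintype B] in
-- Entropy is mean information. Prescribing `φ` only on non-null cells permits replacing the
-- logarithm of a product by a sum of logarithms, an identity that may fail on null cells because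
-- `Real.log 0 = 0`.
theorem labelEntropy_eq_integral [Finite B] {κ : Ω → B} (hκ : ∀ b, MeasurableSet (κ ⁻¹' {b}))
    (ν : Measure Ω) [IsFiniteMeasure ν] {φ : B → ℝ}
    (hφ : ∀ b, ν.real (κ ⁻¹' {b}) ≠ 0 → φ b = -Real.log (ν.real (κ ⁻¹' {b}))) :
    labelEntropy ν κ = ∫ x, φ (κ x) ∂ν := by
  have := Fintype.ofFinite B
  rw [integral_comp_label hκ, labelEntropy, finsum_eq_sum_of_fintype]
  refine Finset.sum_congr rfl fun b _ => ?_
  by_cases hb : ν.real (κ ⁻¹' {b}) = 0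
  · simp [hb]
  · rw [hφ b hb, Real.negMulLog]; ring

/-- Every subprobability vector `q` gives an upper bound. It serves twice: with a product of
averaged marginals for subadditivity and concavity, and with a mixture over ball centres for the
Fano inequality. -/
theorem labelEntropy_le_integral {κ : Ω → B} (hκ : ∀ b, MeasurableSet (κ ⁻¹' {b}))
    (ν : Measure Ω) [IsProbabilityMeasure ν] {q : B → ℝ} (hq : ∀ b, 0 ≤ q b)
    (hq1 : ∑ b, q b ≤ 1) (hpq : ∀ b, ν.real (κ ⁻¹' {b}) ≠ 0 → q b ≠ 0) :
    labelEntropy ν κ ≤ ∫ x, -Real.log (q (κ x)) ∂ν := by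
  rw [integral_comp_label hκ ν fun b => -Real.log (q b), labelEntropy, finsum_eq_sum_of_fintype]
  exact sum_negMulLog_le (fun _ => measureReal_nonneg) (sum_measureReal_label hκ ν) hq hq1 hpq

end Gibbs

/-! ### Entropy of product measures and of averaged marginals -/

section Labels

variable {B : Type*} {X : Type*} [MeasurableSpace X] {ℓ : X → B}
  {V W : Type*} [Fintype V] [Fintype W]

omit [MeasurableSpace X] [Fintype V] in
theorem preimage_comp_label (c : V → B) :
    (fun x : V → X => ℓ ∘ x) ⁻¹' {c} = Set.univ.pi fun v => ℓ ⁻¹' {c v} := by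
  ext x
  simp [funext_iff]

theorem measurableSet_comp_label (hℓ : ∀ b, MeasurableSet (ℓ ⁻¹' {b})) (c : V → B) :
    MeasurableSet ((fun x : V → X => ℓ ∘ x) ⁻¹' {c}) := by
  rw [preimage_comp_label]
  exact MeasurableSet.univ_pi fun v => hℓ _

theorem coinduced_real_label (hℓ : ∀ b, MeasurableSet (ℓ ⁻¹' {b}))
    (ν : ProbabilityMeasure (V → X)) (c : V × W → B) :
    (coinduced W ν : Measure (V × W → X)).real ((fun x => ℓ ∘ x) ⁻¹' {c}) =
      ∏ w, (ν : Measure (V → X)).real ((fun x => ℓ ∘ x) ⁻¹' {fun v => c (v, w)}) := by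
  rw [toMeasure_coinduced, measureReal_def, Measure.map_apply measurable_regroup
    (measurableSet_comp_label hℓ c)]
  have h1 : (fun (y : W → V → X) (p : V × W) => y p.2 p.1) ⁻¹' ((fun x => ℓ ∘ x) ⁻¹' {c}) =
      Set.pi ((Finset.univ : Finset W) : Set W) fun w =>
        (fun x : V → X => ℓ ∘ x) ⁻¹' {fun v => c (v, w)} := by
    ext y
    simp only [Set.mem_preimage, Set.mem_singleton_iff, Set.mem_pi, funext_iff,
      Function.comp_apply, Prod.forall, Finset.coe_univ, Set.mem_univ, true_imp_iff]
    exact forall_comm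
  rw [h1, Measure.infinitePi_pi _ fun w _ => measurableSet_comp_label hℓ _, ENNReal.toReal_prod]
  rfl

variable [Finite B]

/-- The information of a product cell is the sum of the informations of its slices, and each of
these has mean equal to the entropy of `ν`. -/
theorem labelEntropy_coinduced (hℓ : ∀ b, MeasurableSet (ℓ ⁻¹' {b}))
    (ν : ProbabilityMeasure (V → X)) :
    labelEntropy (coinduced W ν : Measure (V × W → X)) (fun x => ℓ ∘ x) =
      Fintype.card W * labelEntropy (ν : Measure (V → X)) fun x => ℓ ∘ x := by
  classical
  set p : (V → B) → ℝ := fun c => (ν : Measure (V → X)).real ((fun x => ℓ ∘ x) ⁻¹' {c}) with hp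
  have hsm : ∀ φ : (V → B) → ℝ, StronglyMeasurable fun x : V → X => φ (ℓ ∘ x) :=
    stronglyMeasurable_comp_label (measurableSet_comp_label hℓ)
  rw [labelEntropy_eq_integral (measurableSet_comp_label hℓ) _
    (φ := fun c : V × W → B => ∑ w, -Real.log (p fun v => c (v, w))),
    integral_coinduced ν (stronglyMeasurable_comp_label (measurableSet_comp_label hℓ)
      fun c : V × W → B => ∑ w, -Real.log (p fun v => c (v, w)))]
  · have h1 : ∀ w : W, Integrable (fun y : W → V → X => -Real.log (p (ℓ ∘ y w)))
        (Measure.infinitePi fun _ : W => (ν : Measure (V → X))) := fun w =>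
      (measurePreserving_eval_infinitePi (fun _ : W => (ν : Measure (V → X))) w).integrable_comp_of_integrable
        (integrable_comp_label (measurableSet_comp_label hℓ) _ fun c => -Real.log (p c))
    refine (integral_finsetSum _ fun w _ => h1 w).trans ?_
    have h2 : ∀ w : W, ∫ y, -Real.log (p (ℓ ∘ y w))
        ∂(Measure.infinitePi fun _ : W => (ν : Measure (V → X))) =
        labelEntropy (ν : Measure (V → X)) fun x => ℓ ∘ x := by
      intro w
      rw [labelEntropy_eq_integral (measurableSet_comp_label hℓ) _
        (φ := fun c => -Real.log (p c)) fun c _ => rfl]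
      exact integral_infinitePi_eval (ν : Measure (V → X)) w (hsm fun c => -Real.log (p c))
    simp only [h2, Finset.sum_const, Finset.card_univ, nsmul_eq_mul]
  · intro c hc
    rw [coinduced_real_label hℓ] at hc ⊢
    rw [Real.log_prod fun w hw => (Finset.prod_ne_zero_iff.1 hc) w hw, Finset.sum_neg_distrib]

omit [Fintype V] in
/-- The average over `w ∈ W` of the marginals on `V × {w}`. -/
def averageMarginal [Nonempty W] (ν : ProbabilityMeasure (V × W → X)) :
    ProbabilityMeasure (V → X) :=
  ⟨(Fintype.card W : ENNReal)⁻¹ • ∑ w : W, (ν : Measure (V × W → X)).map fun x v => x (v, w), ⟨by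
    have h1 : ∀ w : W, ((ν : Measure (V × W → X)).map fun x v => x (v, w)) Set.univ = 1 :=
      fun w => by
        rw [Measure.map_apply (by fun_prop) MeasurableSet.univ, Set.preimage_univ, measure_univ]
    simp only [Measure.smul_apply, Measure.coe_finsetSum, Finset.sum_apply, h1,
      Finset.sum_const, Finset.card_univ, nsmul_eq_mul, mul_one, smul_eq_mul]
    exact ENNReal.inv_mul_cancel (by simp) (by simp)⟩⟩

omit [Fintype V] in
theorem integral_averageMarginal [Nonempty W] (ν : ProbabilityMeasure (V × W → X))
    {f : (V → X) → ℝ} (hf : StronglyMeasurable f)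
    (hfi : ∀ w : W, Integrable (fun x => f fun v => x (v, w)) (ν : Measure (V × W → X))) :
    ∫ x, f x ∂(averageMarginal ν : Measure (V → X)) =
      average fun w => ∫ x, f (fun v => x (v, w)) ∂(ν : Measure (V × W → X)) := by
  rw [averageMarginal, ProbabilityMeasure.coe_mk, integral_smul_measure, integral_finsetSum_measure]
  · simp only [ENNReal.toReal_inv, ENNReal.toReal_natCast, smul_eq_mul, average]
    rw [div_eq_inv_mul]
    congr 1
    exact Finset.sum_congr rfl fun w _ =>
      integral_map (Measurable.aemeasurable (by fun_prop)) hf.aestronglyMeasurable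
  · exact fun w _ => (integrable_map_measure hf.aestronglyMeasurable
      (Measurable.aemeasurable (by fun_prop))).2 (hfi w)

/-- Subadditivity and concavity of Shannon entropy. -/
theorem labelEntropy_le_averageMarginal [Nonempty W] (hℓ : ∀ b, MeasurableSet (ℓ ⁻¹' {b}))
    (ν : ProbabilityMeasure (V × W → X)) :
    labelEntropy (ν : Measure (V × W → X)) (fun x => ℓ ∘ x) ≤
      Fintype.card W * labelEntropy (averageMarginal ν : Measure (V → X)) fun x => ℓ ∘ x := by
  classical
  have := Fintype.ofFinite B
  have hV := measurableSet_comp_label (V := V) hℓ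
  have hVW := measurableSet_comp_label (V := V × W) hℓ
  set p : (V → B) → ℝ :=
    fun c => (averageMarginal ν : Measure (V → X)).real ((fun x => ℓ ∘ x) ⁻¹' {c}) with hp
  have hint : ∀ (φ : (V → B) → ℝ) (w : W), Integrable (fun x : V × W → X =>
      φ (ℓ ∘ fun v => x (v, w))) (ν : Measure (V × W → X)) := fun φ w =>
    integrable_comp_label hVW _ fun c : V × W → B => φ fun v => c (v, w)
  have hav : ∀ φ : (V → B) → ℝ, ∫ x, φ (ℓ ∘ x) ∂(averageMarginal ν : Measure (V → X)) =
      average fun w => ∫ x, φ (ℓ ∘ fun v => x (v, w)) ∂(ν : Measure (V × W → X)) := fun φ =>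
    integral_averageMarginal ν (stronglyMeasurable_comp_label hV φ) (hint φ)
  have hcard : (Fintype.card W : ℝ) ≠ 0 := by simp
  -- A label pattern that is null for the average is null for every slice marginal; this is the
  -- absolute continuity that Gibbs' inequality requires.
  have hpos : ∀ c, (ν : Measure (V × W → X)).real ((fun x => ℓ ∘ x) ⁻¹' {c}) ≠ 0 →
      ∀ w, p (fun v => c (v, w)) ≠ 0 := by
    intro c hc w hw
    refine hc ?_
    have h1 : ∀ b, ∫ x, (if ℓ ∘ x = b then (1 : ℝ) else 0) ∂(averageMarginal ν : Measure (V → X)) =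
        p b := by
      intro b
      rw [integral_comp_label hV _ fun b' => if b' = b then (1 : ℝ) else 0]
      simp [p]
    have h2 := hav fun b => if b = fun v => c (v, w) then (1 : ℝ) else 0
    rw [h1, hw, eq_comm, average, div_eq_zero_iff, or_iff_left hcard,
      Finset.sum_eq_zero_iff_of_nonneg fun w _ => integral_nonneg fun x => by positivity] at h2
    have h3 := h2 w (Finset.mem_univ w)
    have h4 := integral_comp_label hVW (ν : Measure (V × W → X))
      fun c' : V × W → B => if (fun v => c' (v, w)) = fun v => c (v, w) then (1 : ℝ) else 0
    refine le_antisymm ?_ measureReal_nonneg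
    rw [← h3]
    refine le_of_le_of_eq ?_ h4.symm
    refine le_of_eq_of_le ?_ (Finset.single_le_sum (fun c' _ => ?_) (Finset.mem_univ c))
    · simp
    · exact mul_nonneg measureReal_nonneg (by positivity)
  -- Gibbs' inequality against independent copies of the averaged marginal. The cross entropy is
  -- linear in `ν`, so it equals `|W|` times the entropy of the average; subadditivity and concavity
  -- come out together.
  refine (labelEntropy_le_integral hVW _ (q := fun c => ∏ w, p fun v => c (v, w))
    (fun c => Finset.prod_nonneg fun w _ => measureReal_nonneg) ?_ ?_).trans_eq ?_
  · apply le_of_eq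
    let e : (V × W → B) ≃ (W → V → B) :=
      ((Equiv.prodComm V W).arrowCongr (Equiv.refl B)).trans (Equiv.curry W V B)
    have h1 : ∑ c : V × W → B, ∏ w, p (fun v => c (v, w)) = ∑ c : W → V → B, ∏ w, p (c w) :=
      Fintype.sum_equiv e _ _ fun c => rfl
    rw [h1, ← Fintype.prod_sum fun _ : W => p, sum_measureReal_label hV,
      Finset.prod_const_one]
  · exact fun c hc => Finset.prod_ne_zero_iff.2 fun w _ => hpos c hc w
  · have h1 := hav fun c => -Real.log (p c)
    rw [labelEntropy_eq_integral hV _ (φ := fun c => -Real.log (p c)) fun c _ => rfl, h1, average,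
      mul_div_cancel₀ _ hcard, ← integral_finsetSum _ fun w _ => hint (fun c => -Real.log (p c)) w]
    refine (integral_comp_label hVW _ fun c : V × W → B =>
      -Real.log (∏ w, p fun v => c (v, w))).trans (Eq.trans ?_ (integral_comp_label hVW _
        fun c : V × W → B => ∑ w, -Real.log (p fun v => c (v, w))).symm)
    refine Finset.sum_congr rfl fun c _ => ?_
    by_cases hc : (ν : Measure (V × W → X)).real ((fun x => ℓ ∘ x) ⁻¹' {c}) = 0
    · simp [hc]
    · rw [Real.log_prod fun w _ => hpos c hc w, Finset.sum_neg_distrib]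

end Labels

/-! ### Cells of a partition as labels -/

section Cells

variable {X : Type*} (P : Finpartition (Set.univ : Set X))

theorem exists_mem_part (x : X) : ∃ C : P.parts, x ∈ (C : Set X) := by
  have h : x ∈ P.parts.sup id := by rw [P.sup_parts]; trivial
  rw [Finset.sup_id_set_eq_sUnion] at h
  obtain ⟨C, hC, hx⟩ := h
  exact ⟨⟨C, hC⟩, hx⟩

/-- The cell of a partition that contains a given point. -/
def cellOf (x : X) : P.parts := (exists_mem_part P x).choose

theorem mem_cellOf (x : X) : x ∈ (cellOf P x : Set X) := (exists_mem_part P x).choose_spec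

theorem cellOf_eq_iff {x : X} {C : P.parts} : cellOf P x = C ↔ x ∈ (C : Set X) := by
  refine ⟨fun h => h ▸ mem_cellOf P x, fun h => ?_⟩
  by_contra hne
  exact Set.disjoint_left.1 (P.disjoint (cellOf P x).2 C.2 fun h' => hne (Subtype.ext h'))
    (mem_cellOf P x) h

theorem preimage_cellOf (C : P.parts) : cellOf P ⁻¹' {C} = C := by
  ext x
  exact cellOf_eq_iff P

/-- Cells are nonempty, so distinct label patterns give distinct product cells and passing to the
set of cells loses no summand. -/
theorem shannonEntropy_productCells [MeasurableSpace X] {V : Type*} [Fintype V]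
    (ν : ProbabilityMeasure (V → X)) :
    shannonEntropy ν (productCells V P) =
      labelEntropy (ν : Measure (V → X)) fun x => cellOf P ∘ x := by
  classical
  have h1 : productCells V P = Finset.univ.image fun c : V → P.parts =>
      Set.univ.pi fun v => (c v : Set X) := by
    ext S
    simp only [productCells, Finset.mem_image, Fintype.mem_piFinset, Finset.mem_univ, true_and]
    constructor
    · rintro ⟨c, hc, rfl⟩
      exact ⟨fun v => ⟨c v, hc v⟩, rfl⟩
    · rintro ⟨c, rfl⟩
      exact ⟨fun v => c v, fun v => (c v).2, rfl⟩
  have h2 : ∀ c : V → P.parts, (Set.univ.pi fun v => (c v : Set X)) =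
      (fun x : V → X => cellOf P ∘ x) ⁻¹' {c} := by
    intro c
    rw [preimage_comp_label]
    simp only [preimage_cellOf]
  have hinj : Function.Injective fun c : V → P.parts => Set.univ.pi fun v => (c v : Set X) := by
    intro c c' hcc
    have h3 : ∀ v, ∃ x, x ∈ (c v : Set X) := fun v =>
      Set.nonempty_iff_ne_empty.2 (P.ne_bot (c v).2)
    choose x hx using h3
    have h4 : x ∈ Set.univ.pi fun v => (c v : Set X) := fun v _ => hx v
    have h5 : x ∈ Set.univ.pi fun v => (c' v : Set X) := by
      have := hcc; simp only at this; rwa [← this]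
    funext v
    rw [← (cellOf_eq_iff P).2 (h4 v trivial), (cellOf_eq_iff P).2 (h5 v trivial)]
  rw [shannonEntropy, h1, Finset.sum_image hinj.injOn, labelEntropy, finsum_eq_sum_of_fintype]
  simp only [h2]

end Cells

/-! ### Shannon entropy versus covering numbers -/

section Covering

variable {V : Type*} [Fintype V] {X : Type*} [MetricSpace X]

theorem continuous_hammingAverage (x : V → X) : Continuous fun y => hammingAverage y x := by
  unfold hammingAverage
  fun_prop

theorem hammingAverage_lt [Nonempty V] {x y : V → X} {δ : ℝ} (h : ∀ v, dist (x v) (y v) < δ) :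
    hammingAverage x y < δ := by
  rw [← average_const (V := V) δ, hammingAverage, average]
  gcongr with v
  · exact ⟨Classical.arbitrary V, Finset.mem_univ _⟩
  · exact h v

variable [CompactSpace X] [MeasurableSpace X]

/-- By compactness some finite family works, so the infimum is attained and is not the default value
`0` of an empty infimum. -/
theorem exists_card_eq_coveringNumber {ε δ : ℝ} (hε : 0 < ε) (hδ : 0 < δ)
    (ν : ProbabilityMeasure (V → X)) :
    ∃ F : Finset (V → X), F.card = coveringNumber ε δ ν ∧
      1 - ε < (ν : Measure (V → X)).real (⋃ x ∈ F, {y | hammingAverage y x < δ}) := by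
  have h1 : {k : ℕ | ∃ F : Finset (V → X), F.card = k ∧ 1 - ε < (ν : Measure (V → X)).real
      (⋃ x ∈ F, {y | hammingAverage y x < δ})}.Nonempty := by
    obtain ⟨F, -, hF⟩ := isCompact_univ.elim_nhds_subcover
      (fun x : V → X => {y | hammingAverage y x < δ}) fun x _ =>
        (isOpen_lt (continuous_hammingAverage x) continuous_const).mem_nhds
          (by simpa [hammingAverage] using hδ)
    refine ⟨F.card, F, rfl, ?_⟩
    rw [Set.univ_subset_iff.1 hF]
    simpa using hε
  exact Nat.sInf_mem h1

variable [BorelSpace X] {B : Type*} [Finite B] {ℓ : X → B}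

/-- A Fano type inequality: up to a small error, the Shannon entropy of a partition whose cells
have small boundaries is bounded by the logarithm of the covering number. -/
theorem labelEntropy_div_card_le [Nonempty V] (hℓ : ∀ b, MeasurableSet (ℓ ⁻¹' {b}))
    {ε δ r s : ℝ} (hε : 0 < ε) (hε1 : ε ≤ 1) (hδ : 0 < δ) (hr : 0 < r) (hs : 0 < s) (hs1 : s < 1)
    {β : X → ℝ} (hβc : Continuous β) (hβ0 : ∀ x, 0 ≤ β x)
    (hβ : ∀ x y, β x < 1 → dist x y < r → ℓ x = ℓ y) (ν : ProbabilityMeasure (V → X)) :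
    labelEntropy (ν : Measure (V → X)) (fun x => ℓ ∘ x) / Fintype.card V ≤
      Real.log (coveringNumber ε δ ν) / Fintype.card V - Real.log (1 - s) +
        Real.log (Nat.card B / s) *
          (ε + δ / r + average fun v => ∫ x, β (x v) ∂(ν : Measure (V → X))) := by
  classical
  have := Fintype.ofFinite B
  have hV := measurableSet_comp_label (V := V) hℓ
  obtain ⟨x₀⟩ := nonempty_of_isProbabilityMeasure (ν : Measure (V → X))
  have hB : Nonempty B := ⟨ℓ (x₀ (Classical.arbitrary V))⟩
  have hB1 : (1 : ℝ) ≤ Fintype.card B := by exact_mod_cast Fintype.card_pos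
  rw [Nat.card_eq_fintype_card]
  obtain ⟨F, hFN, hF⟩ := exists_card_eq_coveringNumber hε hδ ν
  rw [← hFN]
  set N : ℝ := (F.card : ℝ) with hN
  set n : ℝ := (Fintype.card V : ℝ) with hn
  have hn0 : 0 < n := by simp [hn, Fintype.card_pos]
  have hFne : F.Nonempty := by
    rw [Finset.nonempty_iff_ne_empty]
    rintro rfl
    simp only [Finset.notMem_empty, Set.iUnion_of_empty, Set.iUnion_empty,
      measureReal_empty] at hF
    linarith
  have hN0 : 0 < N := by simpa [hN] using hFne.card_pos
  set U : Set (V → X) := ⋃ x ∈ F, {y | hammingAverage y x < δ} with hU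
  have hUm : MeasurableSet U := (isOpen_biUnion fun x _ =>
    isOpen_lt (continuous_hammingAverage x) continuous_const).measurableSet
  set L := Real.log (Fintype.card B / s) with hL
  have hL0 : 0 ≤ L := Real.log_nonneg ((one_le_div hs).2 (by linarith))
  have hs0 : 0 < 1 - s := by linarith
  have hls : Real.log (1 - s) ≤ 0 := Real.log_nonpos hs0.le (by linarith)
  -- A noisy channel: the label of the centre is kept with weight `1 - s`, and any other label gets
  -- weight `s / |B|`. Its column sums are at most `1`.
  let θ : B → B → ℝ := fun b b' => if b = b' then 1 - s else s / Fintype.card B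
  have hθ0 : ∀ b b', 0 < θ b b' := by
    intro b b'
    simp only [θ]
    split_ifs
    · exact hs0
    · positivity
  have hθ1 : ∀ b', ∑ b, θ b b' ≤ 1 := by
    intro b'
    calc ∑ b, θ b b' ≤ ∑ b, ((if b = b' then 1 - s else 0) + s / Fintype.card B) := by
          refine Finset.sum_le_sum fun b _ => ?_
          simp only [θ]
          split_ifs
          · have : 0 ≤ s / Fintype.card B := by positivity
            linarith
          · simp
      _ = 1 := by
          rw [Finset.sum_add_distrib, Finset.sum_ite_eq' Finset.univ b' fun _ => 1 - s,
            if_pos (Finset.mem_univ _), Finset.sum_const, Finset.card_univ, nsmul_eq_mul,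
            mul_div_cancel₀ _ (by positivity)]
          ring
  have hθlog : ∀ b b', -Real.log (θ b b') ≤ -Real.log (1 - s) + if b = b' then 0 else L := by
    intro b b'
    simp only [θ]
    split_ifs
    · simp
    · rw [← Real.log_inv, inv_div]
      linarith
  let Q : (V → X) → (V → B) → ℝ := fun y c => ∏ v, θ (c v) (ℓ (y v))
  have hQ0 : ∀ y c, 0 < Q y c := fun y c => Finset.prod_pos fun v _ => hθ0 _ _
  -- The uniform mixture over the centres of the label patterns obtained through independent noise.
  -- It costs `log N`, plus `-log (1 - s)` per vertex and at most `L` per error.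
  let q : (V → B) → ℝ := fun c => (∑ y ∈ F, Q y c) / N
  have hq0 : ∀ c, 0 < q c := fun c => div_pos (Finset.sum_pos (fun y _ => hQ0 y c) hFne) hN0
  have hq1 : ∑ c, q c ≤ 1 := by
    simp only [q]
    rw [← Finset.sum_div, Finset.sum_comm, div_le_one hN0]
    calc ∑ y ∈ F, ∑ c, Q y c ≤ ∑ y ∈ F, (1 : ℝ) := by
          refine Finset.sum_le_sum fun y _ => ?_
          simp only [Q]
          rw [← Fintype.prod_sum fun v b => θ b (ℓ (y v))]
          exact Finset.prod_le_one (fun v _ => Finset.sum_nonneg fun b _ => (hθ0 _ _).le)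
            fun v _ => hθ1 _
      _ = N := by simp [hN]
  have hqlog : ∀ y ∈ F, ∀ c, -Real.log (q c) ≤
      Real.log N + n * -Real.log (1 - s) + L * ∑ v, if c v = ℓ (y v) then 0 else 1 := by
    intro y hy c
    have h1 : Q y c / N ≤ q c := by
      simp only [q]
      gcongr
      exact Finset.single_le_sum (f := fun y => Q y c) (fun y _ => (hQ0 y c).le) hy
    have h2 := Real.log_le_log (div_pos (hQ0 y c) hN0) h1
    rw [Real.log_div (hQ0 y c).ne' hN0.ne', Real.log_prod fun v _ => (hθ0 _ _).ne'] at h2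
    have h3 := Finset.sum_le_sum fun v (_ : v ∈ Finset.univ) => hθlog (c v) (ℓ (y v))
    rw [Finset.sum_neg_distrib, Finset.sum_add_distrib, Finset.sum_const, Finset.card_univ,
      nsmul_eq_mul] at h3
    have h4 : ∑ v, (if c v = ℓ (y v) then 0 else L) =
        L * ∑ v, if c v = ℓ (y v) then (0 : ℝ) else 1 := by
      rw [Finset.mul_sum]
      exact Finset.sum_congr rfl fun v _ => by split_ifs <;> simp
    linarith
  -- Inside `U`, a vertex is mislabelled only if its distance to the centre is at least `r`, counted
  -- by `dist / r`, or if `β` is at least `1` there. Outside `U` every vertex is counted as an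
  -- error.
  have hpt : ∀ x : V → X, -Real.log (q (ℓ ∘ x)) ≤ Real.log N + n * -Real.log (1 - s) +
      L * (Uᶜ.indicator (fun _ => n) x + n * (δ / r) + ∑ v, β (x v)) := by
    intro x
    by_cases hx : x ∈ U
    · obtain ⟨y, hy, hxy⟩ := Set.mem_iUnion₂.1 hx
      refine (hqlog y hy _).trans ?_
      gcongr
      rw [Set.indicator_of_notMem (by simpa using hx), zero_add]
      have h1 : ∀ v, (if (ℓ ∘ x) v = ℓ (y v) then (0 : ℝ) else 1) ≤
          dist (x v) (y v) / r + β (x v) := by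
        intro v
        have h2 : 0 ≤ dist (x v) (y v) / r := by positivity
        split_ifs with hv
        · exact add_nonneg h2 (hβ0 _)
        · by_cases hd : dist (x v) (y v) < r
          · have : 1 ≤ β (x v) := by
              by_contra! hlt
              exact hv (hβ _ _ hlt hd)
            linarith
          · have : 1 ≤ dist (x v) (y v) / r := (one_le_div hr).2 (not_lt.1 hd)
            linarith [hβ0 (x v)]
      refine (Finset.sum_le_sum fun v _ => h1 v).trans ?_
      rw [Finset.sum_add_distrib, ← Finset.sum_div, mul_div_assoc']
      gcongr
      have h3 : hammingAverage x y < δ := hxy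
      rw [hammingAverage, div_lt_iff₀ hn0] at h3
      linarith
    · obtain ⟨y, hy⟩ := hFne
      refine (hqlog y hy _).trans ?_
      gcongr
      rw [Set.indicator_of_mem (by simpa using hx)]
      have h1 : ∑ v, (if (ℓ ∘ x) v = ℓ (y v) then (0 : ℝ) else 1) ≤ n := by
        refine (Finset.sum_le_sum (g := fun _ => (1 : ℝ)) fun v _ => ?_).trans_eq (by simp [hn])
        split_ifs <;> norm_num
      have h2 : 0 ≤ n * (δ / r) := by positivity
      have h3 : 0 ≤ ∑ v, β (x v) := Finset.sum_nonneg fun v _ => hβ0 _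
      linarith
  have hi1 : Integrable (Uᶜ.indicator fun _ => n) (ν : Measure (V → X)) :=
    (integrable_const _).indicator hUm.compl
  have hi2 : ∀ v, Integrable (fun x : V → X => β (x v)) (ν : Measure (V → X)) := fun v =>
    integrable_continuousMap _ ⟨fun x : V → X => β (x v), hβc.comp (continuous_apply v)⟩
  have hi3 : Integrable (fun x : V → X => Uᶜ.indicator (fun _ => n) x + n * (δ / r))
      (ν : Measure (V → X)) := hi1.add (integrable_const _)
  have hi4 : Integrable (fun x : V → X => ∑ v, β (x v)) (ν : Measure (V → X)) :=
    integrable_finsetSum _ fun v _ => hi2 v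
  have hi5 : Integrable (fun x : V → X =>
      L * (Uᶜ.indicator (fun _ => n) x + n * (δ / r) + ∑ v, β (x v))) (ν : Measure (V → X)) :=
    (hi3.add hi4).const_mul L
  have hmain : labelEntropy (ν : Measure (V → X)) (fun x => ℓ ∘ x) ≤
      Real.log N + n * -Real.log (1 - s) +
        L * (n * ε + n * (δ / r) + ∑ v, ∫ x, β (x v) ∂(ν : Measure (V → X))) := by
    refine (labelEntropy_le_integral hV _ (fun c => (hq0 c).le) hq1
      fun c _ => (hq0 c).ne').trans ?_
    refine (integral_mono (integrable_comp_label hV _ fun c => -Real.log (q c))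
      ((integrable_const (Real.log N + n * -Real.log (1 - s))).add hi5) hpt).trans ?_
    simp only [Pi.add_apply]
    rw [integral_add (integrable_const _) hi5, integral_const_mul, integral_add hi3 hi4,
      integral_add hi1 (integrable_const _),
      integral_finsetSum _ fun v _ => hi2 v, integral_indicator_const _ hUm.compl,
      probReal_compl_eq_one_sub hUm]
    simp only [integral_const, probReal_univ, smul_eq_mul, one_mul]
    rw [mul_comm n ε]
    gcongr
    linarith
  rw [average, ← hn, div_le_iff₀ hn0]
  refine hmain.trans_eq ?_
  field_simp
  ring

omit [CompactSpace X] [BorelSpace X] in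
/-- Conditioning a measure on the union of the cells of small measure yields a measure whose
Shannon entropy is at least the logarithm of the covering number, up to a constant. -/
theorem exists_labelEntropy_ge [Nonempty V] (hℓ : ∀ b, MeasurableSet (ℓ ⁻¹' {b}))
    {ε δ : ℝ} (hε : 0 < ε) (hℓδ : ∀ x y, ℓ x = ℓ y → dist x y < δ)
    (ν : ProbabilityMeasure (V → X)) :
    ∃ ν' : ProbabilityMeasure (V → X),
      (ν' : Measure (V → X)) ≤ ENNReal.ofReal (max 1 ε⁻¹) • (ν : Measure (V → X)) ∧
      Real.log (coveringNumber ε δ ν) - Real.log (max 1 ε⁻¹) ≤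
        labelEntropy (ν' : Measure (V → X)) fun x => ℓ ∘ x := by
  classical
  have := Fintype.ofFinite B
  have hV := measurableSet_comp_label (V := V) hℓ
  have hC : (1 : ℝ) ≤ max 1 ε⁻¹ := le_max_left _ _
  have hlC : 0 ≤ Real.log (max 1 ε⁻¹) := Real.log_nonneg hC
  -- The value `0` occurs when `1 < ε`, as the empty family then suffices; `Real.log 0 = 0` makes
  -- `ν` itself work.
  rcases Nat.eq_zero_or_pos (coveringNumber ε δ ν) with hN | hN
  · refine ⟨ν, ?_, ?_⟩
    · intro S
      rw [Measure.smul_apply, smul_eq_mul]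
      exact le_mul_of_one_le_left' (by simp)
    · rw [hN, Nat.cast_zero, Real.log_zero]
      linarith [labelEntropy_nonneg (ν : Measure (V → X)) fun x : V → X => ℓ ∘ x]
  set N : ℝ := (coveringNumber ε δ ν : ℝ) with hNdef
  have hN0 : 0 < N := Nat.cast_pos.2 hN
  set p : (V → B) → ℝ := fun c => (ν : Measure (V → X)).real ((fun x => ℓ ∘ x) ⁻¹' {c}) with hp
  set A : Set (V → X) := {x | p (ℓ ∘ x) ≤ 1 / N} with hA
  have hAm : MeasurableSet A :=
    measurableSet_le (stronglyMeasurable_comp_label hV p).measurable measurable_const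
  -- Fewer than `N` cells have mass above `1 / N`. If they carried more than `1 - ε`, one ball for
  -- each would contradict the minimality of `N`.
  have hAε : ε ≤ (ν : Measure (V → X)).real A := by
    by_contra! hlt
    set T : Finset (V → B) := Finset.univ.filter fun c => 1 / N < p c with hT
    have hTN : (T.card : ℝ) < N := by
      rcases T.eq_empty_or_nonempty with h0 | h0
      · simpa [h0] using hN0
      · have h1 : ∑ c ∈ T, 1 / N < ∑ c ∈ T, p c :=
          Finset.sum_lt_sum_of_nonempty h0 fun c hc => (Finset.mem_filter.1 hc).2
        have h2 : ∑ c ∈ T, p c ≤ 1 := (Finset.sum_le_univ_sum_of_nonneg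
          fun c => measureReal_nonneg).trans_eq (sum_measureReal_label hV _)
        rw [Finset.sum_const, nsmul_eq_mul, mul_one_div] at h1
        exact (div_lt_one hN0).1 (h1.trans_le h2)
    have hne : ∀ c ∈ T, ∃ x : V → X, ℓ ∘ x = c := by
      intro c hc
      by_contra! hcon
      have h1 : (fun x : V → X => ℓ ∘ x) ⁻¹' {c} = ∅ := by
        ext x; simp [hcon x]
      have h2 := (Finset.mem_filter.1 hc).2
      simp only [hp, h1, measureReal_empty] at h2
      exact absurd h2 (not_lt.2 (by positivity))
    obtain ⟨x₀⟩ := nonempty_of_isProbabilityMeasure (ν : Measure (V → X))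
    have : Nonempty (V → X) := ⟨x₀⟩
    choose! x hx using hne
    have hsub : Aᶜ ⊆ ⋃ z ∈ T.image x, {y | hammingAverage y z < δ} := by
      intro y hy
      have hyT : ℓ ∘ y ∈ T := Finset.mem_filter.2 ⟨Finset.mem_univ _, not_le.1 hy⟩
      refine Set.mem_iUnion₂.2 ⟨x (ℓ ∘ y), Finset.mem_image_of_mem x hyT, ?_⟩
      exact hammingAverage_lt fun v => hℓδ _ _ (congrFun (hx _ hyT) v).symm
    have h3 : coveringNumber ε δ ν ≤ (T.image x).card := by
      refine Nat.sInf_le ⟨T.image x, rfl, ?_⟩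
      refine lt_of_lt_of_le ?_ (measureReal_mono hsub (measure_ne_top _ _))
      rw [probReal_compl_eq_one_sub hAm]
      linarith
    have h4 : N ≤ T.card := by
      rw [hNdef]; exact_mod_cast h3.trans Finset.card_image_le
    linarith
  have hA0 : (ν : Measure (V → X)) A ≠ 0 := by
    intro h0
    rw [measureReal_def, h0] at hAε
    simp only [ENNReal.toReal_zero] at hAε
    linarith
  have hprob := ProbabilityTheory.cond_isProbabilityMeasure hA0
  refine ⟨⟨ProbabilityTheory.cond (ν : Measure (V → X)) A, hprob⟩, ?_, ?_⟩
  · intro S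
    rw [ProbabilityMeasure.coe_mk, ProbabilityTheory.cond, Measure.smul_apply, Measure.smul_apply,
      smul_eq_mul, smul_eq_mul]
    gcongr
    · have h1 : ENNReal.ofReal ε ≤ (ν : Measure (V → X)) A :=
        ENNReal.ofReal_le_of_le_toReal hAε
      refine (ENNReal.inv_le_inv.2 h1).trans ?_
      rw [← ENNReal.ofReal_inv_of_pos hε]
      exact ENNReal.ofReal_le_ofReal (le_max_right _ _)
    · exact Measure.restrict_le_self
  · have hcond : ∀ S, (ProbabilityTheory.cond (ν : Measure (V → X)) A).real S =
        ((ν : Measure (V → X)).real A)⁻¹ * (ν : Measure (V → X)).real (A ∩ S) := fun S => by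
      simp only [measureReal_def, ProbabilityTheory.cond_apply hAm, ENNReal.toReal_mul,
        ENNReal.toReal_inv]
    rw [ProbabilityMeasure.coe_mk]
    set m := ProbabilityTheory.cond (ν : Measure (V → X)) A with hm
    -- Conditioning discards the heavy cells and enlarges the light ones by a factor of at most
    -- `ε⁻¹`. A uniform bound on cell masses bounds the entropy from below.
    have hle : ∀ c, m.real ((fun x => ℓ ∘ x) ⁻¹' {c}) ≤ max 1 ε⁻¹ / N := by
      intro c
      by_cases hc : p c ≤ 1 / N
      · rw [hcond]
        have h1 : ((ν : Measure (V → X)).real A)⁻¹ ≤ max 1 ε⁻¹ :=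
          ((inv_le_inv₀ (hε.trans_le hAε) hε).2 hAε).trans (le_max_right _ _)
        rw [div_eq_mul_one_div]
        exact mul_le_mul h1 ((measureReal_mono Set.inter_subset_right).trans hc)
          measureReal_nonneg (by positivity)
      · have h1 : A ∩ (fun x => ℓ ∘ x) ⁻¹' {c} = ∅ := by
          ext x
          simp only [Set.mem_inter_iff, Set.mem_preimage, Set.mem_singleton_iff,
            Set.mem_empty_iff_false, iff_false, not_and]
          rintro hx rfl
          exact hc hx
        rw [hcond, h1]
        simp only [measureReal_empty, mul_zero]
        positivity
    have h2 : ∀ c, m.real ((fun x => ℓ ∘ x) ⁻¹' {c}) *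
        (Real.log N - Real.log (max 1 ε⁻¹)) ≤
          Real.negMulLog (m.real ((fun x => ℓ ∘ x) ⁻¹' {c})) := by
      intro c
      rcases (measureReal_nonneg (μ := m) (s := (fun x => ℓ ∘ x) ⁻¹' {c})).eq_or_lt with h0 | h0
      · simp [← h0]
      · have h3 := Real.log_le_log h0 (hle c)
        rw [Real.log_div (by positivity) hN0.ne'] at h3
        rw [Real.negMulLog, neg_mul, ← mul_neg]
        gcongr
        linarith
    have h3 := Finset.sum_le_sum fun c (_ : c ∈ Finset.univ) => h2 c
    rw [← Finset.sum_mul, sum_measureReal_label hV, one_mul] at h3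
    rwa [labelEntropy, finsum_eq_sum_of_fintype]

end Covering

/-! ### Local convergence of averaged marginals -/

section AverageMarginal

variable {ι X : Type*} [MetricSpace X] [CompactSpace X] [MeasurableSpace X]
  [BorelSpace X]

/-- The function `(x, y) ↦ F x * F y`, as a function of configurations of pairs. -/
def tensorSquare (F : C(ι → X, ℝ)) : C(ι → X × X, ℝ) :=
  ⟨fun z => F (fun i => (z i).1) * F fun i => (z i).2, by fun_prop⟩

/-- A squared mean is a mean over two independent copies; hence squared local integrals are visible
to doubly empirical convergence. -/
theorem integral_pairMeasure_comp [Countable ι] {κ : Type*} [Countable κ]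
    (m : ProbabilityMeasure (κ → X)) (F : C(ι → X, ℝ)) (π : ι → κ) :
    ∫ z, tensorSquare F (fun i => z (π i)) ∂(pairMeasure m m : Measure (κ → X × X)) =
      (∫ x, F (fun i => x (π i)) ∂(m : Measure (κ → X))) ^ 2 := by
  have hc : Continuous fun z : κ → X × X => tensorSquare F fun i => z (π i) := by fun_prop
  rw [toMeasure_pairMeasure, integral_map measurable_pairing.aemeasurable
    hc.stronglyMeasurable.aestronglyMeasurable, sq]
  exact integral_prod_mul (fun x : κ → X => F fun i => x (π i))
    fun x : κ → X => F fun i => x (π i)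

omit [MetricSpace X] [CompactSpace X] [BorelSpace X] in
theorem pairMeasure_le {ν ν' : ProbabilityMeasure (ι → X)} {c : ENNReal} (hc : c ≠ ⊤)
    (h : (ν' : Measure (ι → X)) ≤ c • (ν : Measure (ι → X))) :
    (pairMeasure ν' ν' : Measure (ι → X × X)) ≤
      (c * c) • (pairMeasure ν ν : Measure (ι → X × X)) := by
  rw [toMeasure_pairMeasure, toMeasure_pairMeasure, ← Measure.map_smul]
  refine Measure.map_mono ?_ measurable_pairing
  have : SFinite (c • (ν : Measure (ι → X))) := by
    have := Measure.smul_finite (ν : Measure (ι → X)) hc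
    infer_instance
  refine (Measure.prod_mono h h).trans_eq ?_
  rw [Measure.prod_smul_left, Measure.prod_smul_right, smul_smul]

variable {G : Type*} [Countable G] {H : Type*} [Countable H]

/-- After centring `f`, its tensor square has integral zero under the limit. Jensen's inequality
bounds the left side by the mean square of the local integrals under `ν'`, which is the integral
over `ν' × ν'` of an empirical average of the tensor square. -/
theorem sq_localDiscrepancy_averageMarginal_le [One H] {V W : Type*} [Fintype V] [Fintype W]
    [Nonempty V] [Nonempty W] (σ : G → Equiv.Perm V) (τ : H → Equiv.Perm W)
    {ν ν' : ProbabilityMeasure (V × W → X)} (μ : ProbabilityMeasure (G → X)) {C : ℝ} (hC : 0 ≤ C)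
    (h : (ν' : Measure (V × W → X)) ≤ ENNReal.ofReal C • (ν : Measure (V × W → X)))
    (f : C(G → X, ℝ)) :
    localDiscrepancy σ (averageMarginal ν') μ f ^ 2 ≤
      C ^ 2 * empiricalDiscrepancy (prodPerm σ τ) (pairMeasure ν ν)
        (pairMeasure (coinduced H μ) (coinduced H μ))
        (tensorSquare ((f - .const _ (∫ y, f y ∂(μ : Measure (G → X)))).comp
          (slice (1 : H)))) := by
  set c := ∫ y, f y ∂(μ : Measure (G → X)) with hc
  set f₀ : C(G → X, ℝ) := f - .const _ c with hf₀
  set F : C(G × H → X, ℝ) := f₀.comp (slice (1 : H)) with hF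
  let A : V × W → ℝ := fun p =>
    ∫ x, F (pullbackName (prodPerm σ τ) p x) ∂(ν' : Measure (V × W → X))
  have hcont : ∀ v w, Continuous fun x : V × W → X => pullbackName σ v fun v => x (v, w) :=
    fun v w => (continuous_pullbackName σ v).comp (by fun_prop)
  have h1 : ∀ v, ∫ x, f (pullbackName σ v x) ∂(averageMarginal ν' : Measure (V → X)) - c =
      average fun w => A (v, w) := by
    intro v
    have hint : ∀ w, Integrable (fun x : V × W → X => f (pullbackName σ v fun v => x (v, w)))
        (ν' : Measure (V × W → X)) := fun w =>
      integrable_continuousMap _ ⟨_, f.continuous.comp (hcont v w)⟩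
    -- `τ 1` need not be the identity, but it permutes `W`, so the average may be reindexed by it.
    rw [integral_averageMarginal ν' (f := fun x => f (pullbackName σ v x))
      (f.continuous.comp (continuous_pullbackName σ v)).stronglyMeasurable hint,
      ← average_equiv (τ 1)]
    have h2 : ∀ w, A (v, w) = ∫ x, f (pullbackName σ v fun v => x (v, τ 1 w))
        ∂(ν' : Measure (V × W → X)) - c := by
      intro w
      have h3 : ∀ x : V × W → X, F (pullbackName (prodPerm σ τ) (v, w) x) =
          f (pullbackName σ v fun v => x (v, τ 1 w)) - c := fun x => rfl
      simp only [A, h3]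
      rw [integral_sub (hint _) (integrable_const _)]
      simp
    simp only [h2]
    rw [average_sub, average_const]
  have h2 : localDiscrepancy σ (averageMarginal ν') μ f ≤ average fun p => |A p| := by
    rw [localDiscrepancy_apply, average_prod]
    refine average_mono fun v => ?_
    rw [h1]
    exact abs_average_le _
  have h3 : (average fun p => |A p|) ^ 2 ≤ average fun p => A p ^ 2 := by
    simpa only [sq_abs] using average_sq_le fun p => |A p|
  have h4 : ∫ y, tensorSquare F y ∂(pairMeasure (coinduced H μ) (coinduced H μ) :
      Measure (G × H → X × X)) = 0 := by
    refine (integral_pairMeasure_comp (coinduced H μ) F id).trans ?_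
    have h5 : ∫ x, F x ∂(coinduced H μ : Measure (G × H → X)) = ∫ y, f₀ y ∂(μ : Measure (G → X)) := by
      rw [integral_coinduced μ F.continuous.stronglyMeasurable]
      exact integral_infinitePi_eval _ (1 : H) f₀.continuous.stronglyMeasurable
    have h6 : ∫ y, f₀ y ∂(μ : Measure (G → X)) = 0 := by
      simp only [hf₀, ContinuousMap.sub_apply, ContinuousMap.const_apply]
      rw [integral_sub (integrable_continuousMap _ f) (integrable_const _)]
      simp [hc]
    simp only [id]
    rw [h5, h6]
    norm_num
  have hint2 : ∀ p, Integrable (fun z : V × W → X × X =>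
      tensorSquare F (pullbackName (prodPerm σ τ) p z))
      (pairMeasure ν' ν' : Measure (V × W → X × X)) := fun p =>
    integrable_continuousMap _
      ⟨_, (tensorSquare F).continuous.comp (continuous_pullbackName (prodPerm σ τ) p)⟩
  have h5 : (average fun p => A p ^ 2) ≤ ∫ z, discrepancy (empirical (prodPerm σ τ) z)
      (pairMeasure (coinduced H μ) (coinduced H μ)) (tensorSquare F)
        ∂(pairMeasure ν' ν' : Measure (V × W → X × X)) := by
    have h6 : (average fun p => A p ^ 2) = ∫ z, average (fun p => tensorSquare F
        (pullbackName (prodPerm σ τ) p z)) ∂(pairMeasure ν' ν' : Measure (V × W → X × X)) := by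
      rw [integral_average _ hint2]
      congr 1
      ext p
      exact (integral_pairMeasure_comp ν' F fun g => prodPerm σ τ g p).symm
    rw [h6]
    refine integral_mono ((integrable_finsetSum _ fun p _ => hint2 p).div_const _)
      (integrable_discrepancy_empirical _ _ _ _) fun z => ?_
    simp only [discrepancy_empirical, h4, sub_zero]
    exact le_abs_self _
  have h6 : ∫ z, discrepancy (empirical (prodPerm σ τ) z)
      (pairMeasure (coinduced H μ) (coinduced H μ)) (tensorSquare F)
        ∂(pairMeasure ν' ν' : Measure (V × W → X × X)) ≤
      C ^ 2 * empiricalDiscrepancy (prodPerm σ τ) (pairMeasure ν ν)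
        (pairMeasure (coinduced H μ) (coinduced H μ)) (tensorSquare F) := by
    -- The absolute value in the discrepancy makes the integrand nonnegative, so domination of `ν'`
    -- by `C • ν` can be used, once for each copy.
    refine (integral_mono_measure (pairMeasure_le ENNReal.ofReal_ne_top h)
      (ae_of_all _ fun z => apply_nonneg _ _)
      ((integrable_discrepancy_empirical _ _ _ _).smul_measure
        (ENNReal.mul_ne_top ENNReal.ofReal_ne_top ENNReal.ofReal_ne_top))).trans_eq ?_
    rw [integral_smul_measure, ENNReal.toReal_mul, ENNReal.toReal_ofReal hC, smul_eq_mul, ← sq]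
    rfl
  calc _ ≤ (average fun p => |A p|) ^ 2 := by
        gcongr
    _ ≤ _ := h3.trans (h5.trans h6)

/-- If `ν` converges locally and doubly empirically to a co-induced measure, then the averages
over the second factor of measures dominated by `ν` converge locally weak*. -/
theorem LDEConverges.lwConverges_averageMarginal [One H] {V W : ℕ → Type*} [∀ i, Fintype (V i)]
    [∀ i, Nonempty (V i)] [∀ i, Fintype (W i)] [∀ i, Nonempty (W i)]
    {σ : ∀ i, G → Equiv.Perm (V i)} {τ : ∀ i, H → Equiv.Perm (W i)}
    {ν ν' : ∀ i, ProbabilityMeasure (V i × W i → X)} {μ : ProbabilityMeasure (G → X)}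
    (hν : LDEConverges (fun i => prodPerm (σ i) (τ i)) ν (coinduced H μ)) {C : ℝ} (hC : 0 ≤ C)
    (h : ∀ i, (ν' i : Measure (V i × W i → X)) ≤
      ENNReal.ofReal C • (ν i : Measure (V i × W i → X))) :
    LWConverges σ (fun i => averageMarginal (ν' i)) μ := by
  refine .of_tendsto fun f => squeeze_zero (fun i => apply_nonneg _ _) (fun i =>
    Real.le_sqrt_of_sq_le (sq_localDiscrepancy_averageMarginal_le (σ i) (τ i) μ hC (h i) f)) ?_
  have h1 := ((tendsto_empiricalDiscrepancy hν.2 (tensorSquare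
    ((f - .const _ (∫ y, f y ∂(μ : Measure (G → X)))).comp (slice (1 : H))))).const_mul
      (C ^ 2)).sqrt
  simpa using h1

end AverageMarginal

/-! ### Partitions with null boundaries -/

section Boundary

variable {X : Type*} [MetricSpace X] [CompactSpace X] [MeasurableSpace X] [BorelSpace X]

/-- The union of the frontiers is closed and null, so thin thickened indicators of it have small
integral. Off the thickening, the interiors of the cells cover a compact set, and `r` is a Lebesgue
number of this cover. -/
theorem exists_continuous_boundary (P : Finpartition (Set.univ : Set X)) (m : Measure X)
    [IsProbabilityMeasure m] (hm : ∀ C ∈ P.parts, m (frontier C) = 0) {η : ℝ} (hη : 0 < η) :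
    ∃ (β : X → ℝ) (r : ℝ), Continuous β ∧ (∀ x, 0 ≤ β x) ∧ ∫ x, β x ∂m < η ∧ 0 < r ∧
      ∀ x y, β x < 1 → dist x y < r → cellOf P x = cellOf P y := by
  set E : Set X := ⋃ C ∈ P.parts, frontier C with hE
  have hEc : IsClosed E := isClosed_biUnion_finset fun C _ => isClosed_frontier
  have hE0 : m E = 0 := (measure_biUnion_null_iff P.parts.countable_toSet).2 hm
  have h1 := tendsto_integral_thickenedIndicator_of_isClosed m hEc
    (fun n : ℕ => Nat.one_div_pos_of_nat (α := ℝ) (n := n)) tendsto_one_div_add_atTop_nhds_zero_nat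
  rw [measureReal_def, hE0, ENNReal.toReal_zero] at h1
  obtain ⟨n, hn⟩ := (h1.eventually (gt_mem_nhds (half_pos hη))).exists
  have hpos : (0 : ℝ) < 1 / ((n : ℝ) + 1) := Nat.one_div_pos_of_nat
  -- With the factor `2`, `β` equals `2` on the frontiers, so the compact set `{β ≤ 1}` avoids them.
  set β : X → ℝ := fun x => 2 * (thickenedIndicator hpos E x : ℝ) with hβ
  have hβc : Continuous β := by fun_prop
  have hK : IsCompact {x | β x ≤ 1} := (isClosed_le hβc continuous_const).isCompact
  obtain ⟨r, hr, hrK⟩ := lebesgue_number_lemma_of_metric hK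
    (c := fun C : P.parts => interior (C : Set X)) (fun _ => isOpen_interior) (by
      intro x hx
      refine Set.mem_iUnion.2 ⟨cellOf P x, ?_⟩
      by_contra hxi
      have hxE : x ∈ E := Set.mem_iUnion₂.2
        ⟨_, (cellOf P x).2, subset_closure (mem_cellOf P x), hxi⟩
      have h2 := thickenedIndicator_one hpos E hxE
      have h3 : β x ≤ 1 := hx
      simp only [hβ, h2] at h3
      norm_num at h3)
  refine ⟨β, r, hβc, fun x => by positivity, ?_, hr, fun x y hx hxy => ?_⟩
  · simp only [hβ]
    rw [integral_const_mul]
    linarith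
  · obtain ⟨C, hC⟩ := hrK x (le_of_lt hx)
    rw [(cellOf_eq_iff P).2 (interior_subset (hC (Metric.mem_ball_self hr))),
      (cellOf_eq_iff P).2 (interior_subset (hC (Metric.mem_ball'.2 hxy)))]

variable {G : Type*} [Countable G] {V : ℕ → Type*} [∀ i, Fintype (V i)] [∀ i, Nonempty (V i)]
  {σ : ∀ i, G → Equiv.Perm (V i)} {ν : ∀ i, ProbabilityMeasure (V i → X)}
  {μ : ProbabilityMeasure (G → X)}

/-- A test function of the single coordinate `g` sees the vertex `σ i g v` from `v`; averaging over
`v` removes this permutation. -/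
theorem LWConverges.eventually_average_lt (h : LWConverges σ ν μ) (g : G) {β : X → ℝ}
    (hβ : Continuous β) {η : ℝ} (hη : ∫ x, β (x g) ∂(μ : Measure (G → X)) < η) :
    ∀ᶠ i in atTop, (average fun v => ∫ x, β (x v) ∂(ν i : Measure (V i → X))) < η := by
  have h1 := h.tendsto_localDiscrepancy ⟨fun x => β (x g), hβ.comp (continuous_apply g)⟩
  filter_upwards [h1.eventually (gt_mem_nhds (sub_pos.2 hη))] with i hi
  rw [localDiscrepancy_apply] at hi
  have h2 := (le_abs_self _).trans_lt ((abs_average_le _).trans_lt hi)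
  rw [average_sub, average_const] at h2
  rw [← average_equiv (σ i g)]
  simp only [ContinuousMap.coe_mk, pullbackName] at h2
  linarith

end Boundary

/-- The error `θ` is handled between real numbers, so no arithmetic with a possibly infinite `M` is
needed. -/
theorem limsup_coe_le_of_forall_eventually_le {a : ℕ → ℝ} {M : EReal}
    (h : ∀ θ : ℝ, 0 < θ → ∃ b : ℕ → ℝ, limsup (fun i => (b i : EReal)) atTop ≤ M ∧
      ∀ᶠ i in atTop, a i ≤ b i + θ) : limsup (fun i => (a i : EReal)) atTop ≤ M := by
  refine le_of_forall_lt_imp_le_of_dense fun d hd => ?_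
  obtain ⟨t, hdt, ht⟩ := EReal.lt_iff_exists_real_btwn.1 hd
  obtain ⟨t', htt', ht'⟩ := EReal.lt_iff_exists_real_btwn.1 ht
  obtain ⟨b, hb, hab⟩ := h (t' - t) (sub_pos.2 (EReal.coe_lt_coe_iff.1 htt'))
  refine hdt.le.trans (le_trans ?_ hb)
  refine le_limsup_of_frequently_le (((frequently_lt_of_lt_limsup (by isBoundedDefault)
    ht').and_eventually hab).mono fun i hi => ?_) (by isBoundedDefault)
  have h1 := EReal.coe_lt_coe_iff.1 hi.1
  exact EReal.coe_le_coe_iff.2 (by linarith [hi.2])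

/-! ### The two inequalities -/

section Main

variable {G : Type*} [Group G] [Countable G] {H : Type*} [Group H] [Countable H]
  {V : ℕ → Type*} [∀ n, Fintype (V n)] [∀ n, Nonempty (V n)]
  {W : ℕ → Type*} [∀ n, Fintype (W n)] [∀ n, Nonempty (W n)]
  {σ : ∀ n, G → Equiv.Perm (V n)} {τ : ∀ n, H → Equiv.Perm (W n)}
  {X : Type*} [MetricSpace X] [CompactSpace X] [MeasurableSpace X] [BorelSpace X]
  {μ : ProbabilityMeasure (G → X)} {𝔓 : Set (Finpartition (Set.univ : Set X))}

theorem lwShannonEntropy_le_modelMeasureEntropy (hτ : IsSoficApprox τ)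
    (hW : Tendsto (fun n => Fintype.card (W n)) atTop atTop)
    (h𝔓 : IsBorelFamily 𝔓) (hPii : HasContinuityCells μ 𝔓) :
    lwShannonEntropy σ μ 𝔓 ≤ modelMeasureEntropy (prodApprox σ τ) (coinduced H μ) := by
  refine iSup₂_le fun P hP => iSup₂_le fun n hn => iSup₂_le fun ν hν => ?_
  have hτn := hτ.comp hn
  have hWn := hW.comp hn.tendsto_atTop
  have hℓ : ∀ C, MeasurableSet (cellOf P ⁻¹' {C}) := fun C => by
    rw [preimage_cellOf]; exact h𝔓 P hP C C.2
  have hLDE := hν.ldeConverges_coinduced hτn hWn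
  have hLW := hν.coinduced (H := H) hτn
  refine limsup_coe_le_of_forall_eventually_le fun θ hθ => ?_
  -- Chosen so that the noise costs `-log (1 - s) = θ / 4` per vertex.
  set s := 1 - Real.exp (-(θ / 4)) with hs
  have hs0 : 0 < s := sub_pos.2 (Real.exp_lt_one_iff.2 (by linarith))
  have hs1 : s < 1 := sub_lt_self _ (Real.exp_pos _)
  have hslog : Real.log (1 - s) = -(θ / 4) := by rw [hs, sub_sub_cancel, Real.log_exp]
  set L := Real.log (Nat.card P.parts / s) with hL
  have hL0 : 0 ≤ L := by
    obtain ⟨x⟩ := nonempty_of_isProbabilityMeasure (μ : Measure (G → X))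
    have : Nonempty P.parts := ⟨cellOf P (x 1)⟩
    have h1 : (1 : ℝ) ≤ Nat.card P.parts := by exact_mod_cast Nat.card_pos
    exact Real.log_nonneg ((one_le_div hs0).2 (by linarith))
  -- Three errors of size at most `η`, weighted by `L`, use the remaining `3 * θ / 4`; `L + 1` is
  -- positive even if `L` vanishes.
  set η := θ / (4 * (L + 1)) with hη
  have hη0 : 0 < η := by positivity
  have hηL : L * (3 * η) ≤ 3 * (θ / 4) := by
    rw [hη]
    have : L * (3 * (θ / (4 * (L + 1)))) = 3 * (θ / 4) * (L / (L + 1)) := by field_simp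
    rw [this]
    exact mul_le_of_le_one_right (by positivity) (div_le_one_of_le₀ (by linarith) (by linarith))
  have hprob : IsProbabilityMeasure ((μ : Measure (G → X)).map fun x => x 1) :=
    Measure.isProbabilityMeasure_map (measurable_pi_apply 1).aemeasurable
  obtain ⟨β, r, hβc, hβ0, hβη, hr, hβr⟩ := exists_continuous_boundary P
    ((μ : Measure (G → X)).map fun x => x 1) (fun C hC => by
      rw [Measure.map_apply (measurable_pi_apply 1) isClosed_frontier.measurableSet]
      exact hPii P hP C hC) hη0
  rw [integral_map (measurable_pi_apply 1).aemeasurable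
    hβc.stronglyMeasurable.aestronglyMeasurable] at hβη
  have hβη' : ∫ x, β (x ((1 : G), (1 : H))) ∂(coinduced H μ : Measure (G × H → X)) < η := by
    have hc : Continuous fun x : G × H → X => β (x (1, 1)) := by fun_prop
    rw [integral_coinduced μ hc.stronglyMeasurable]
    exact (integral_infinitePi_eval (μ : Measure (G → X)) (1 : H)
      (hβc.comp (continuous_apply (1 : G))).stronglyMeasurable).trans_lt hβη
  -- The Fano inequality requires `ε ≤ 1`, and the radius `r * η` makes its term `δ / r` equal to
  -- `η`.
  refine ⟨fun i => Real.log (coveringNumber (min 1 η) (r * η) (coinduced (W (n i)) (ν i))) /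
    Fintype.card (V (n i) × W (n i)), ?_, ?_⟩
  · unfold modelMeasureEntropy
    refine le_trans ?_ (le_iSup₂ n hn)
    refine le_trans ?_ (le_iSup₂ (fun i => coinduced (W (n i)) (ν i)) hLDE)
    refine le_trans ?_ (le_iSup₂ (min 1 η) (lt_min one_pos hη0))
    exact le_iSup₂ (f := fun (δ : ℝ) (_ : 0 < δ) => limsup (fun i =>
      ((Real.log (coveringNumber (min 1 η) δ (coinduced (W (n i)) (ν i))) /
        Fintype.card (V (n i) × W (n i)) : ℝ) : EReal)) atTop) (r * η) (by positivity)
  · filter_upwards [hLW.eventually_average_lt ((1 : G), (1 : H)) hβc hβη'] with i hi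
    have h1 := labelEntropy_div_card_le hℓ (lt_min one_pos hη0) (min_le_left 1 η)
      (mul_pos hr hη0) hr hs0 hs1 hβc hβ0 hβr (coinduced (W (n i)) (ν i))
    rw [labelEntropy_coinduced hℓ, ← shannonEntropy_productCells, hslog, ← hL,
      mul_div_cancel_left₀ _ hr.ne', Fintype.card_prod, Nat.cast_mul, mul_comm (Nat.cast _),
      mul_div_mul_right _ _ (by simp)] at h1
    rw [Fintype.card_prod, Nat.cast_mul]
    have h2 : L * (min 1 η + η + average fun v =>
        ∫ x, β (x v) ∂(coinduced (W (n i)) (ν i) : Measure (V (n i) × W (n i) → X))) ≤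
        L * (3 * η) := by
      gcongr
      linarith [min_le_right 1 η]
    linarith

omit [Group G] in
theorem modelMeasureEntropy_le_lwShannonEntropy
    (hW : Tendsto (fun n => Fintype.card (W n)) atTop atTop)
    (h𝔓 : IsBorelFamily 𝔓) (hPi : HasSmallCells 𝔓) :
    modelMeasureEntropy (prodApprox σ τ) (coinduced H μ) ≤ lwShannonEntropy σ μ 𝔓 := by
  refine iSup₂_le fun n hn => iSup₂_le fun ν hν => iSup₂_le fun ε hε => iSup₂_le fun δ hδ => ?_
  obtain ⟨P, hP, hPδ⟩ := hPi δ hδ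
  have hℓ : ∀ C, MeasurableSet (cellOf P ⁻¹' {C}) := fun C => by
    rw [preimage_cellOf]; exact h𝔓 P hP C C.2
  -- Compactness bounds the cells, so a small `Metric.diam` really bounds distances and is not the
  -- default value of an unbounded set.
  have hℓδ : ∀ x y, cellOf P x = cellOf P y → dist x y < δ := fun x y hxy =>
    (Metric.dist_le_diam_of_mem (Metric.isBounded_of_compactSpace (s := (cellOf P x : Set X)))
      (mem_cellOf P x) (hxy ▸ mem_cellOf P y)).trans_lt (hPδ _ (cellOf P x).2)
  have hWn := hW.comp hn.tendsto_atTop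
  choose ν' hν'le hν' using fun i => exists_labelEntropy_ge hℓ hε hℓδ (ν i)
  have hLW : LWConverges (fun i => σ (n i)) (fun i => averageMarginal (ν' i)) μ :=
    LDEConverges.lwConverges_averageMarginal (τ := fun i => τ (n i)) hν
      (zero_le_one.trans (le_max_left 1 ε⁻¹)) hν'le
  have hC : 0 ≤ Real.log (max 1 ε⁻¹) := Real.log_nonneg (le_max_left _ _)
  have h0 : Tendsto (fun i => Real.log (max 1 ε⁻¹) / (Fintype.card (W (n i)) : ℝ)) atTop (𝓝 0) :=
    ((tendsto_natCast_atTop_atTop (R := ℝ)).comp hWn).const_div_atTop _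
  refine limsup_coe_le_of_forall_eventually_le fun θ hθ => ?_
  refine ⟨fun i => shannonEntropy (averageMarginal (ν' i)) (productCells (V (n i)) P) /
    Fintype.card (V (n i)), ?_, ?_⟩
  · unfold lwShannonEntropy
    refine le_trans ?_ (le_iSup₂ P hP)
    refine le_trans ?_ (le_iSup₂ n hn)
    exact le_iSup₂ (f := fun (ν : ∀ i, ProbabilityMeasure (V (n i) → X))
      (_ : LWConverges (fun i => σ (n i)) ν μ) => limsup (fun i =>
        ((shannonEntropy (ν i) (productCells (V (n i)) P) / Fintype.card (V (n i)) : ℝ) : EReal))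
          atTop) (fun i => averageMarginal (ν' i)) hLW
  · filter_upwards [h0.eventually (gt_mem_nhds hθ)] with i hi
    have h1 := (hν' i).trans (labelEntropy_le_averageMarginal hℓ (ν' i))
    rw [← shannonEntropy_productCells] at h1
    have hw : (0 : ℝ) < Fintype.card (W (n i)) := by exact_mod_cast Fintype.card_pos
    have hv : (1 : ℝ) ≤ Fintype.card (V (n i)) := by exact_mod_cast Fintype.card_pos
    rw [div_lt_iff₀ hw] at hi
    rw [Fintype.card_prod, Nat.cast_mul, div_le_iff₀ (by positivity)]
    -- As `|V| ≥ 1`, a loss of less than `θ` per element of `W` is a loss of less than `θ` per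
    -- element of `V × W`.
    have h2 : θ * Fintype.card (W (n i)) ≤
        θ * (Fintype.card (V (n i)) * Fintype.card (W (n i))) := by
      gcongr
      exact le_mul_of_one_le_left hw.le hv
    have h3 : (shannonEntropy (averageMarginal (ν' i)) (productCells (V (n i)) P) /
        Fintype.card (V (n i)) + θ) * (Fintype.card (V (n i)) * Fintype.card (W (n i))) =
        Fintype.card (W (n i)) *
          shannonEntropy (averageMarginal (ν' i)) (productCells (V (n i)) P) +
        θ * (Fintype.card (V (n i)) * Fintype.card (W (n i))) := by
      field_simp
    rw [h3]
    linarith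

end Main

end

end SoficEntropy

theorem theoremC {G : Type*} [Group G] [Countable G] {H : Type*} [Group H] [Countable H]
    {V : ℕ → Type*} [∀ n, Fintype (V n)] [∀ n, Nonempty (V n)]
    {W : ℕ → Type*} [∀ n, Fintype (W n)] [∀ n, Nonempty (W n)]
    (σ : ∀ n, G → Equiv.Perm (V n)) (hσ : IsSoficApprox σ)
    (τ : ∀ n, H → Equiv.Perm (W n)) (hτ : IsSoficApprox τ)
    (hW : Filter.Tendsto (fun n => Fintype.card (W n)) Filter.atTop Filter.atTop)
    {X : Type*} [MetricSpace X] [CompactSpace X] [MeasurableSpace X] [BorelSpace X]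
    (μ : MeasureTheory.ProbabilityMeasure (G → X)) (hμ : ShiftInvariant μ)
    (𝔓 : Set (Finpartition (Set.univ : Set X))) (h𝔓 : IsBorelFamily 𝔓)
    (hPi : HasSmallCells 𝔓) (hPii : HasContinuityCells μ 𝔓) :
    modelMeasureEntropy (prodApprox σ τ) (coinduced H μ) = lwShannonEntropy σ μ 𝔓 :=
  le_antisymm (modelMeasureEntropy_le_lwShannonEntropy hW h𝔓 hPi)
    (lwShannonEntropy_le_modelMeasureEntropy hτ hW h𝔓 hPii)
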